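/- Let $\Bbbk$ be a field, let $q\in\Bbbk^*$ be not a root of unity (that is, $q\neq 0$ and $q^m\neq 1$ for all integers $m\geq 1$), and let $t,n\geq 1$ be integers. Let $\mathscr{H}_q^t$ be the associative unital $\Bbbk$-algebra with generators $\Omega,\Omega^{-1},\Psi,\Psi^{\dagger}$ and defining relations $$\Omega\Omega^{-1}=\Omega^{-1}\Omega=1,\qquad \Psi\Omega=q\,\Omega\Psi,\qquad \Psi^{\dagger}\Omega=q^{-1}\,\Omega\Psi^{\dagger},$$ $$\Psi\Psi^{\dagger}=\frac{q^t\Omega^t-q^{-t}\Omega^{-t}}{q^t-q^{-t}},\qquad \Psi^{\dagger}\Psi=\frac{\Omega^t-\Omega^{-t}}{q^t-q^{-t}}.$$ Then every $\Bbbk$-algebra endomorphism of the $n$-fold tensor power $\mathscr{H}_q^t\otimes_{\Bbbk}\cdots\otimes_{\Bbbk}\mathscr{H}_q^t$ is an automorphism. -/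

import Mathlib

open scoped TensorProduct

namespace WeylHayashi

/-- The four generators `Ω`, `Ω⁻¹`, `Ψ`, `Ψ†`. -/
inductive Gen : Type
  | Omega
  | OmegaInv
  | Psi
  | PsiDag

variable (k : Type*) [Field k]

/-- The generator `Ω` of the free associative algebra. -/
def Ω : FreeAlgebra k Gen := FreeAlgebra.ι k Gen.Omega

/-- The generator `Ω⁻¹` of the free associative algebra. -/
def Ωinv : FreeAlgebra k Gen := FreeAlgebra.ι k Gen.OmegaInv

/-- The generator `Ψ` of the free associative algebra. -/
def Ψ : FreeAlgebra k Gen := FreeAlgebra.ι k Gen.Psi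

/-- The generator `Ψ†` of the free associative algebra. -/
def Ψdag : FreeAlgebra k Gen := FreeAlgebra.ι k Gen.PsiDag

/-- The defining relations of the Weyl-Hayashi algebra:
`Ω Ω⁻¹ = Ω⁻¹ Ω = 1`, `Ψ Ω = q Ω Ψ`, `Ψ† Ω = q⁻¹ Ω Ψ†`,
`Ψ Ψ† = (q^t Ω^t - q^{-t} Ω^{-t}) / (q^t - q^{-t})` and
`Ψ† Ψ = (Ω^t - Ω^{-t}) / (q^t - q^{-t})`. -/
inductive Rel (q : k) (t : ℕ) : FreeAlgebra k Gen → FreeAlgebra k Gen → Prop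
  | omega_mul_inv : Rel q t (Ω k * Ωinv k) 1
  | inv_mul_omega : Rel q t (Ωinv k * Ω k) 1
  | psi_omega : Rel q t (Ψ k * Ω k) (q • (Ω k * Ψ k))
  | psiDag_omega : Rel q t (Ψdag k * Ω k) (q⁻¹ • (Ω k * Ψdag k))
  | psi_psiDag : Rel q t (Ψ k * Ψdag k)
      ((q ^ t - (q ^ t)⁻¹)⁻¹ • (q ^ t • Ω k ^ t - (q ^ t)⁻¹ • Ωinv k ^ t))
  | psiDag_psi : Rel q t (Ψdag k * Ψ k)
      ((q ^ t - (q ^ t)⁻¹)⁻¹ • (Ω k ^ t - Ωinv k ^ t))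

end WeylHayashi

/-- The algebra `H_q^t`: the free associative `k`-algebra on `Ω, Ω⁻¹, Ψ, Ψ†` modulo the
two-sided ideal generated by the relations `WeylHayashi.Rel`. -/
abbrev WeylHayashiAlgebra (k : Type*) [Field k] (q : k) (t : ℕ) : Type _ :=
  RingQuot (WeylHayashi.Rel k q t)

/-! The tensor power embeds, by `rep`, in a quantum torus: Laurent polynomials in variables ω_i,
extended by invertible shifts X_i. Here Ω_i ↦ ω_i, Ψ_i ↦ X_i and Ψ†_i ↦ b_i X_i⁻¹ with b_i = (ω_i^t
- ω_i^{-t})/(q^t - q^{-t}). The asymmetry between Ψ and Ψ† is what matters: a component of negative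
degree in X_j has left coefficient divisible by the non-unit b_j (`bracket_dvd_comp_rep`).

Let φ be an endomorphism. Units of the torus are homogeneous, and the divisibility, applied to a
unit and to its inverse, forces degree 0; so φ(Ω_i) is sent to some c_i ω^{α_i} (`exists_rep_unit`).
Since q has infinite order, commutation with these elements detects degrees: a degree m occurring in
the image of Ψ_i satisfies m·α_j = δ_ij. The images do not vanish, so such degrees exist and form an
integer matrix M inverse to the transpose of α; hence Ψ_i and Ψ†_i have homogeneous images of
degrees M_i and -M_i (`exists_degree`). Independence of the degrees makes φ injective
(`injective_of_graded`).

For surjectivity, the image of Ψ†_iΨ_i is a bracket in c_i ω^{α_i}, divisible by a rescaled b_j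
whenever M_ij ≠ 0. Specializing ω_j at a root shows that α_i is supported at j. With M_i·α_i = 1
this gives M_i = α_i = ±e_j (`exists_eq_single_of_degree`), and i ↦ j is a permutation. Cancelling
brackets leaves units c ω^b, so the generators of the j-th factor are, up to such units, images of
generators of the i-th, with Ψ and Ψ† exchanged when the sign is negative. -/

set_option linter.unusedSectionVars false

/-! ### Units of group algebras and skew group algebras -/

namespace AddMonoidAlgebra

/-- Units of a group algebra with two unique sums are monomials. -/
theorem exists_eq_single_of_mul_eq_one {R A : Type*} [Semiring R] [NoZeroDivisors R] [Nontrivial R]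
    [AddMonoid A] [TwoUniqueSums A] {x y : AddMonoidAlgebra R A} (h : x * y = 1) :
    ∃ a c, c ≠ 0 ∧ x = single a c := by
  classical
  have hx : x ≠ 0 := by rintro rfl; simp at h
  have hy : y ≠ 0 := by rintro rfl; simp at h
  have hx' : 0 < x.coeff.support.card := by
    rwa [Finset.card_pos, Finsupp.support_nonempty_iff, ne_eq, coeff_eq_zero]
  have hy' : 0 < y.coeff.support.card := by
    rwa [Finset.card_pos, Finsupp.support_nonempty_iff, ne_eq, coeff_eq_zero]
  -- A uniquely represented sum carries a nonzero coefficient of `x * y = 1`, so it is 0. Two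
  -- distinct such pairs would both sum to 0, contradicting uniqueness; hence the support of `x` is
  -- a single point.
  have key : ∀ p ∈ x.coeff.support ×ˢ y.coeff.support,
      UniqueAdd x.coeff.support y.coeff.support p.1 p.2 → p.1 + p.2 = 0 := by
    intro p hp hu
    have h1 := coeff_mul_add_of_uniqueAdd hu
    rw [h, one_def, coeff_single, Finsupp.single_apply] at h1
    rw [Finset.mem_product, Finsupp.mem_support_iff, Finsupp.mem_support_iff] at hp
    by_contra hne
    rw [if_neg (fun h => hne h.symm)] at h1
    exact mul_ne_zero hp.1 hp.2 h1.symm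
  have hcard : x.coeff.support.card = 1 := by
    by_contra hne
    obtain ⟨p, hp, r, hr, hpr, hup, hur⟩ :=
      TwoUniqueSums.uniqueAdd_of_one_lt_card (A := x.coeff.support) (B := y.coeff.support)
        (by nlinarith [show 2 ≤ x.coeff.support.card by omega])
    have h2 := hup (Finset.mem_product.1 hr).1 (Finset.mem_product.1 hr).2
      ((key r hr hur).trans (key p hp hup).symm)
    exact hpr (Prod.ext h2.1.symm h2.2.symm)
  obtain ⟨a, c, hc, hac⟩ := Finsupp.card_support_eq_one'.1 hcard
  exact ⟨a, c, hc, coeff_injective hac⟩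

end AddMonoidAlgebra

namespace SkewMonoidAlgebra

variable {R G : Type*} [Semiring R]

theorem coeff_mul_mul_of_uniqueMul [Monoid G] [MulSemiringAction G R]
    {f g : SkewMonoidAlgebra R G} {a b : G} (h : UniqueMul f.support g.support a b) :
    (f * g).coeff (a * b) = f.coeff a * a • g.coeff b := by
  classical
  rw [coeff_mul]
  simp_rw [sum_def', ← Finset.sum_product']
  refine (Finset.sum_eq_single (a, b) ?_ ?_).trans (if_pos rfl) <;> simp_rw [Finset.mem_product]
  · refine fun ab hab hne => if_neg fun he => hne <| Prod.ext ?_ ?_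
    exacts [(h hab.1 hab.2 he).1, (h hab.1 hab.2 he).2]
  · refine fun hn => ite_eq_right_iff.mpr fun _ => ?_
    rcases not_and_or.mp hn with af | bg
    · rw [notMem_support_iff.mp af, zero_mul]
    · rw [notMem_support_iff.mp bg, smul_zero, mul_zero]

/-- Units of a skew group algebra with two unique products are homogeneous. -/
theorem exists_eq_single_of_mul_eq_one [NoZeroDivisors R] [Nontrivial R] [Group G]
    [TwoUniqueProds G] [MulSemiringAction G R] {x y : SkewMonoidAlgebra R G} (h : x * y = 1) :
    ∃ a c, c ≠ 0 ∧ x = single a c := by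
  classical
  have hx : x ≠ 0 := by rintro rfl; simp at h
  have hy : y ≠ 0 := by rintro rfl; simp at h
  have hx' : 0 < x.support.card := by
    rwa [Finset.card_pos, Finset.nonempty_iff_ne_empty, ne_eq, support_eq_empty]
  have hy' : 0 < y.support.card := by
    rwa [Finset.card_pos, Finset.nonempty_iff_ne_empty, ne_eq, support_eq_empty]
  have key : ∀ p ∈ x.support ×ˢ y.support,
      UniqueMul x.support y.support p.1 p.2 → p.1 * p.2 = 1 := by
    intro p hp hu
    have h1 := coeff_mul_mul_of_uniqueMul hu
    rw [h, one_def, coeff_single, Finsupp.single_apply] at h1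
    rw [Finset.mem_product, mem_support_iff, mem_support_iff] at hp
    by_contra hne
    rw [if_neg (fun h => hne h.symm)] at h1
    exact mul_ne_zero hp.1 (fun h0 => hp.2 ((smul_eq_zero_iff_eq _).1 h0)) h1.symm
  have hcard : x.support.card = 1 := by
    by_contra hne
    obtain ⟨p, hp, r, hr, hpr, hup, hur⟩ :=
      TwoUniqueProds.uniqueMul_of_one_lt_card (A := x.support) (B := y.support)
        (by nlinarith [show 2 ≤ x.support.card by omega])
    have h2 := hup (Finset.mem_product.1 hr).1 (Finset.mem_product.1 hr).2
      ((key r hr hur).trans (key p hp hup).symm)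
    exact hpr (Prod.ext h2.1.symm h2.2.symm)
  rw [← support_coeff] at hcard
  obtain ⟨a, c, hc, hac⟩ := Finsupp.card_support_eq_one'.1 hcard
  exact ⟨a, c, hc, coeff_injective hac⟩

end SkewMonoidAlgebra

/-! ### The quantum torus -/

namespace WeylHayashi

/-- The ring of Laurent polynomials in variables indexed by `ι`. -/
abbrev Laurent (k ι : Type*) [Field k] := AddMonoidAlgebra k (ι → ℤ)

/-- The lattice `ι → ℤ`, written multiplicatively and acting on Laurent polynomials by
rescaling the variables with powers of `u`. -/
def ShiftGroup {k : Type*} [Field k] (_u : kˣ) (ι : Type*) := Multiplicative (ι → ℤ)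

section Torus

variable {k ι : Type*} [Field k] (u : kˣ)

instance : CommGroup (ShiftGroup u ι) := inferInstanceAs (CommGroup (Multiplicative (ι → ℤ)))

/-- The element of `ShiftGroup` given by a lattice vector. -/
def toShift (m : ι → ℤ) : ShiftGroup u ι := Multiplicative.ofAdd m

instance [Finite ι] : TwoUniqueProds (ShiftGroup u ι) :=
  inferInstanceAs (TwoUniqueProds (Multiplicative (ι → ℤ)))

variable [Fintype ι]

/-- The automorphism `ω^a ↦ u^{m·a} ω^a` of Laurent polynomials. -/
noncomputable def shift (m : ι → ℤ) : Laurent k ι →ₐ[k] Laurent k ι :=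
  AddMonoidAlgebra.lift k (Laurent k ι) (ι → ℤ)
    { toFun := fun a =>
        AddMonoidAlgebra.single a.toAdd ((u ^ (m ⬝ᵥ a.toAdd) : kˣ) : k)
      map_one' := by simp [AddMonoidAlgebra.one_def]
      map_mul' := fun a b => by
        simp [AddMonoidAlgebra.single_mul_single, dotProduct_add, zpow_add] }

@[simp] theorem shift_single (m a : ι → ℤ) (c : k) :
    shift u m (AddMonoidAlgebra.single a c) =
      AddMonoidAlgebra.single a (c * ((u ^ (m ⬝ᵥ a) : kˣ) : k)) := by
  simp [shift, AddMonoidAlgebra.lift_single]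

theorem Laurent.algHom_ext {B : Type*} [Semiring B] [Algebra k B] {f g : Laurent k ι →ₐ[k] B}
    (h : ∀ a, f (AddMonoidAlgebra.single a 1) = g (AddMonoidAlgebra.single a 1)) : f = g :=
  AddMonoidAlgebra.algHom_ext h (by ext)

theorem shift_zero : shift u (0 : ι → ℤ) = AlgHom.id k (Laurent k ι) :=
  Laurent.algHom_ext fun a => by simp

theorem shift_add (m l : ι → ℤ) : shift u (m + l) = (shift u m).comp (shift u l) :=
  Laurent.algHom_ext fun a => by simp [add_dotProduct, zpow_add, mul_comm]

/-- The action depends on `u`, which is why `ShiftGroup` carries `u` as a phantom parameter: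
instance search can then recover it. -/
noncomputable instance : MulSemiringAction (ShiftGroup u ι) (Laurent k ι) where
  smul g r := shift u (Multiplicative.toAdd (α := ι → ℤ) g) r
  one_smul r := DFunLike.congr_fun (shift_zero u) r
  mul_smul _ _ r := DFunLike.congr_fun (shift_add u _ _) r
  smul_zero _ := map_zero _
  smul_add _ := map_add _
  smul_one _ := map_one _
  smul_mul _ := map_mul _

instance : SMulCommClass (ShiftGroup u ι) k (Laurent k ι) where
  smul_comm g c r := map_smul (shift u (Multiplicative.toAdd (α := ι → ℤ) g)) c r

/-- The skew Laurent ring over the Laurent polynomials; a quantum torus. -/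
abbrev Torus (ι : Type*) [Fintype ι] := SkewMonoidAlgebra (Laurent k ι) (ShiftGroup u ι)

/-- The homogeneous element `r X^m` of the torus. -/
noncomputable def mono (m : ι → ℤ) (r : Laurent k ι) : Torus u ι :=
  SkewMonoidAlgebra.single (toShift u m) r

/-- The left coefficient at `X^m` of an element of the torus. -/
noncomputable def comp (m : ι → ℤ) : Torus u ι →ₗ[k] Laurent k ι where
  toFun x := x.coeff (toShift u m)
  map_add' x y := by rw [SkewMonoidAlgebra.coeff_add, Finsupp.add_apply]
  map_smul' c x := by rw [SkewMonoidAlgebra.coeff_smul, Finsupp.smul_apply, RingHom.id_apply]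

theorem torus_ext {x y : Torus u ι} (h : ∀ m, comp u m x = comp u m y) : x = y :=
  SkewMonoidAlgebra.ext fun m => h (Multiplicative.toAdd (α := ι → ℤ) m)

theorem comp_mono_self (m : ι → ℤ) (r : Laurent k ι) : comp u m (mono u m r) = r := by
  classical
  exact (SkewMonoidAlgebra.coeff_single_apply (a := toShift u m)).trans (if_pos rfl)

theorem comp_mono_of_ne {m l : ι → ℤ} (h : m ≠ l) (r : Laurent k ι) :
    comp u l (mono u m r) = 0 := by
  classical
  exact (SkewMonoidAlgebra.coeff_single_apply (a := toShift u m) (a' := toShift u l)).trans (if_neg h)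

theorem mono_mul_mono (m l : ι → ℤ) (r s : Laurent k ι) :
    mono u m r * mono u l s = mono u (m + l) (r * shift u m s) :=
  SkewMonoidAlgebra.single_mul_single

theorem one_eq_mono : (1 : Torus u ι) = mono u 0 1 := rfl

theorem mono_injective (m : ι → ℤ) : Function.Injective (mono u m) :=
  SkewMonoidAlgebra.single_injective _

theorem smul_mono (c : k) (m : ι → ℤ) (r : Laurent k ι) : c • mono u m r = mono u m (c • r) :=
  SkewMonoidAlgebra.smul_single _ _ _

theorem mono_add (m : ι → ℤ) (r s : Laurent k ι) : mono u m (r + s) = mono u m r + mono u m s :=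
  SkewMonoidAlgebra.single_add _ _ _

@[simp] theorem mono_zero (m : ι → ℤ) : mono u m (0 : Laurent k ι) = 0 :=
  SkewMonoidAlgebra.single_zero _

theorem mono_eq_zero {m : ι → ℤ} {r : Laurent k ι} : mono u m r = 0 ↔ r = 0 :=
  SkewMonoidAlgebra.single_eq_zero

theorem mono_sub (m : ι → ℤ) (r s : Laurent k ι) : mono u m (r - s) = mono u m r - mono u m s := by
  rw [eq_sub_iff_add_eq, ← mono_add, sub_add_cancel]

theorem comp_mono_mul (m l : ι → ℤ) (r : Laurent k ι) (x : Torus u ι) :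
    comp u l (mono u m r * x) = r * shift u m (comp u (l - m) x) := by
  refine (SkewMonoidAlgebra.coeff_single_mul r (toShift u m) x (toShift u l)).trans ?_
  rw [show l - m = -m + l by abel]
  rfl

theorem comp_mul_mono (m l : ι → ℤ) (r : Laurent k ι) (x : Torus u ι) :
    comp u l (x * mono u m r) = comp u (l - m) x * shift u (l - m) r := by
  refine (SkewMonoidAlgebra.coeff_mul_single x r (toShift u m) (toShift u l)).trans ?_
  rw [sub_eq_add_neg]
  rfl

theorem exists_eq_mono_of_mul_eq_one {x y : Torus u ι} (h : x * y = 1) :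
    ∃ m r, r ≠ 0 ∧ x = mono u m r := by
  obtain ⟨a, c, hc, rfl⟩ := SkewMonoidAlgebra.exists_eq_single_of_mul_eq_one h
  exact ⟨Multiplicative.toAdd (α := ι → ℤ) a, c, hc, rfl⟩

instance : Nontrivial (Torus u ι) :=
  ⟨1, 0, fun h => one_ne_zero ((mono_eq_zero u).1 ((one_eq_mono u).symm.trans h))⟩

theorem isUnit_of_isUnit_shift {m : ι → ℤ} {r : Laurent k ι} (h : IsUnit (shift u m r)) :
    IsUnit r := by
  have := h.map (shift u (-m))
  rwa [← AlgHom.comp_apply, ← shift_add, neg_add_cancel, shift_zero] at this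

/-- The lattice has two unique sums, so a unit has one-point support. -/
theorem isUnit_laurent_iff {r : Laurent k ι} :
    IsUnit r ↔ ∃ a, ∃ c : kˣ, r = AddMonoidAlgebra.single a (c : k) := by
  constructor
  · intro h
    obtain ⟨s, hs⟩ := h.exists_right_inv
    obtain ⟨a, c, hc, rfl⟩ := AddMonoidAlgebra.exists_eq_single_of_mul_eq_one hs
    exact ⟨a, Units.mk0 c hc, rfl⟩
  · rintro ⟨a, c, rfl⟩
    refine IsUnit.of_mul_eq_one (AddMonoidAlgebra.single (-a) ((c⁻¹ : kˣ) : k)) ?_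
    simp [AddMonoidAlgebra.single_mul_single, AddMonoidAlgebra.one_def]

/-- `mono` embeds families of nonzero Laurent polynomials in distinct degrees linearly
independently. -/
theorem linearIndependent_mono {κ κ' : Type*} {M : κ → ι → ℤ} (hM : M.Injective)
    {f : κ → κ' → Laurent k ι} (hf : ∀ m, LinearIndependent k (f m)) :
    LinearIndependent k fun p : (_ : κ) × κ' => mono u (M p.1) (f p.1 p.2) := by
  classical
  rw [linearIndependent_iff']
  intro s g hg p hp
  have h1 : ∑ x ∈ s with x.1 = p.1, g x • f p.1 x.2 = 0 := by
    have := congrArg (comp u (M p.1)) hg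
    rw [map_sum, map_zero] at this
    rw [Finset.sum_filter]
    refine Eq.trans ?_ this
    refine Finset.sum_congr rfl fun x _ => ?_
    split_ifs with h
    · rw [map_smul, ← h, comp_mono_self]
    · rw [map_smul, comp_mono_of_ne u (fun h' => h (hM h')), smul_zero]
  -- The fibre of `s` over `p.1` is reindexed by second components, with coefficients extended by
  -- zero, to match the index type of `f p.1`.
  have h2 : ∑ a ∈ s.image Sigma.snd, (if (⟨p.1, a⟩ : (_ : κ) × κ') ∈ s then g ⟨p.1, a⟩ else 0) •
      f p.1 a = 0 := by
    rw [← h1]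
    simp_rw [ite_smul, zero_smul]
    rw [← Finset.sum_filter]
    refine Finset.sum_bij' (fun a _ => ⟨p.1, a⟩) (fun x _ => x.2) ?_ ?_ ?_ ?_ ?_
    · intro a ha; simpa using (Finset.mem_filter.1 ha).2
    · rintro ⟨a, b⟩ hx
      obtain ⟨hx1, rfl⟩ := Finset.mem_filter.1 hx
      exact Finset.mem_filter.2 ⟨Finset.mem_image_of_mem _ hx1, hx1⟩
    · intro a _; rfl
    · rintro ⟨a, b⟩ hx
      obtain ⟨hx1, rfl⟩ := Finset.mem_filter.1 hx
      rfl
    · intro a _; rfl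
  have h3 := linearIndependent_iff'.1 (hf p.1) _ _ h2 p.2 (Finset.mem_image_of_mem _ hp)
  rwa [if_pos hp] at h3

end Torus

end WeylHayashi

/-! ### Brackets and their specializations -/

namespace WeylHayashi

section Bracket

variable {k ι : Type*} [Field k] (u : kˣ) (t : ℕ)

/-- The Laurent polynomial `(c^t ω^{ta} - c^{-t} ω^{-ta}) / (u^t - u^{-t})`. -/
noncomputable def bracket (c : kˣ) (a : ι → ℤ) : Laurent k ι :=
  ((u : k) ^ t - ((u : k) ^ t)⁻¹)⁻¹ • (AddMonoidAlgebra.single (t • a) ((c ^ t : kˣ) : k) -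
    AddMonoidAlgebra.single (-(t • a)) (((c ^ t)⁻¹ : kˣ) : k))

/-- Specialization of the variable `ω_j` at `s`. -/
noncomputable def specialize [DecidableEq ι] (j : ι) (s : kˣ) : Laurent k ι →ₐ[k] Laurent k ι :=
  AddMonoidAlgebra.lift k (Laurent k ι) (ι → ℤ)
    { toFun := fun a =>
        AddMonoidAlgebra.single (Function.update a.toAdd j 0) ((s ^ (a.toAdd j) : kˣ) : k)
      map_one' := by simp [AddMonoidAlgebra.one_def]
      map_mul' := fun a b => by
        rw [AddMonoidAlgebra.single_mul_single, ← Units.val_mul, ← zpow_add, ← Function.update_add,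
          add_zero]
        rfl }

theorem specialize_single [DecidableEq ι] (j : ι) (s : kˣ) (a : ι → ℤ) (c : k) :
    specialize j s (AddMonoidAlgebra.single a c) =
      AddMonoidAlgebra.single (Function.update a j 0) (c * ((s ^ (a j) : kˣ) : k)) := by
  simp [specialize, AddMonoidAlgebra.lift_single]

theorem shift_bracket [Fintype ι] (m a : ι → ℤ) (c : kˣ) :
    shift u m (bracket u t c a) = bracket u t (c * u ^ (m ⬝ᵥ a)) a := by
  have h : (m ⬝ᵥ (t • a)) = (m ⬝ᵥ a) * t := by
    rw [dotProduct_smul, nsmul_eq_mul, mul_comm]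
  rw [bracket, map_smul, map_sub, shift_single, shift_single, bracket, dotProduct_neg, h,
    ← Units.val_mul, ← Units.val_mul, zpow_neg, zpow_mul, zpow_natCast, mul_pow, mul_inv]

theorem specialize_bracket [DecidableEq ι] (j : ι) (s c : kˣ) (a : ι → ℤ) :
    specialize j s (bracket u t c a) = bracket u t (c * s ^ (a j)) (Function.update a j 0) := by
  have h1 : Function.update (t • a) j 0 = t • Function.update a j 0 := by
    rw [← Function.update_smul, smul_zero]
  have h2 : Function.update (-(t • a)) j 0 = -(t • Function.update a j 0) := by
    rw [← h1, ← Function.update_neg, neg_zero]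
  have h3 : (t • a) j = a j * t := by simp [mul_comm]
  rw [bracket, map_smul, map_sub, specialize_single, specialize_single, bracket, Pi.neg_apply, h1,
    h2, h3, ← Units.val_mul, ← Units.val_mul, zpow_neg, zpow_mul, zpow_natCast, mul_pow, mul_inv]

@[simp] theorem bracket_one_zero : bracket u t 1 (0 : ι → ℤ) = 0 := by
  simp [bracket]

theorem bracket_neg_neg (c : kˣ) (a : ι → ℤ) : bracket u t c⁻¹ (-a) = -bracket u t c a := by
  simp [bracket, ← smul_neg]

variable {u t}

/-- Vanishing would give `u ^ (2t) = 1`. -/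
theorem denominator_ne_zero (hu : ¬IsOfFinOrder u) (ht : 0 < t) :
    (u : k) ^ t - ((u : k) ^ t)⁻¹ ≠ 0 := by
  intro h
  rw [sub_eq_zero] at h
  have h' : u ^ t = (u ^ t)⁻¹ := by ext; simpa using h
  apply hu
  rw [isOfFinOrder_iff_pow_eq_one]
  refine ⟨t * 2, by omega, ?_⟩
  rw [pow_mul, pow_two]
  nth_rw 2 [h']
  exact mul_inv_cancel _

/-- The two monomials have nonzero coefficients, so they cancel only if the exponents `ta` and `-ta`
agree. This is a comparison of integers, valid in every characteristic. -/
theorem bracket_eq_zero (hu : ¬IsOfFinOrder u) (ht : 0 < t) {c : kˣ} {a : ι → ℤ}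
    (h : bracket u t c a = 0) : a = 0 ∧ c ^ t = (c ^ t)⁻¹ := by
  rw [bracket, smul_eq_zero_iff_right (inv_ne_zero (denominator_ne_zero hu ht)), sub_eq_zero] at h
  have h' := congrArg AddMonoidAlgebra.coeff h
  rw [AddMonoidAlgebra.coeff_single, AddMonoidAlgebra.coeff_single,
    Finsupp.single_eq_single_iff] at h'
  rcases h' with ⟨h1, h2⟩ | ⟨h1, -⟩
  · refine ⟨?_, Units.ext h2⟩
    funext i
    have h3 : (t : ℤ) * a i = -((t : ℤ) * a i) := by simpa using congrFun h1 i
    have h4 : (t : ℤ) * a i = 0 := by linarith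
    exact (mul_eq_zero.1 h4).resolve_left (by positivity)
  · exact absurd h1 (Units.ne_zero _)

theorem bracket_ne_zero (hu : ¬IsOfFinOrder u) (ht : 0 < t) (c : kˣ) {a : ι → ℤ} (ha : a ≠ 0) :
    bracket u t c a ≠ 0 := fun h => ha (bracket_eq_zero hu ht h).1

variable [DecidableEq ι]

/-- The root ω_j = d⁻¹ is all that the divisibility arguments need; no factorization theory of
Laurent polynomials enters. -/
theorem specialize_bracket_single (j : ι) (d : kˣ) :
    specialize j d⁻¹ (bracket u t d (Pi.single j 1)) = 0 := by
  rw [specialize_bracket, Pi.single_eq_same, zpow_one, mul_inv_cancel, Pi.single,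
    Function.update_idem]
  simp

theorem not_isUnit_bracket (d : kˣ) (j : ι) :
    ¬IsUnit (bracket u t d (Pi.single j 1) : Laurent k ι) := by
  intro h
  have := h.map (specialize j d⁻¹)
  rw [specialize_bracket_single] at this
  exact not_isUnit_zero this

/-- A bracket divisible by the bracket of a single variable depends on that variable only. -/
theorem apply_eq_zero_of_bracket_dvd (hu : ¬IsOfFinOrder u) (ht : 0 < t) {c d : kˣ} {j : ι}
    {a : ι → ℤ} (h : bracket u t d (Pi.single j 1) ∣ bracket u t c a) {l : ι} (hl : l ≠ j) :
    a l = 0 := by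
  have h1 := map_dvd (specialize j d⁻¹) h
  rw [specialize_bracket_single, zero_dvd_iff, specialize_bracket] at h1
  have := congrFun (bracket_eq_zero hu ht h1).1 l
  rwa [Function.update_of_ne hl] at this

/-- Evaluating at the root ω_j = d⁻¹ gives e^t = e^{-t} for e = c/d. The two brackets then differ by
the scalar e^t, and cancellation identifies `h` with it. -/
theorem isUnit_of_mul_bracket [Finite ι] (hu : ¬IsOfFinOrder u) (ht : 0 < t) {c d : kˣ} {j : ι}
    {h : Laurent k ι}
    (hh : h * bracket u t d (Pi.single j 1) = bracket u t c (Pi.single j 1)) : IsUnit h := by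
  have h1 := congrArg (specialize j d⁻¹) hh
  rw [map_mul, specialize_bracket_single, mul_zero, specialize_bracket] at h1
  have h2 := (bracket_eq_zero hu ht h1.symm).2
  rw [Pi.single_eq_same, zpow_one] at h2
  obtain ⟨e, rfl⟩ : ∃ e, c = e * d := ⟨c * d⁻¹, by simp⟩
  rw [mul_inv_cancel_right] at h2
  have h3 : bracket u t (e * d) (Pi.single j 1) =
      algebraMap k (Laurent k ι) ((e ^ t : kˣ) : k) * bracket u t d (Pi.single j 1) := by
    rw [← Algebra.smul_def, bracket, bracket, smul_comm ((e ^ t : kˣ) : k), smul_sub ((e ^ t : kˣ) : k),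
      AddMonoidAlgebra.smul_single, AddMonoidAlgebra.smul_single, mul_pow, mul_inv, ← h2]
    simp
  rw [h3] at hh
  rw [mul_right_cancel₀ (bracket_ne_zero hu ht d (by simp)) hh]
  exact (Units.isUnit _).map _

theorem isUnit_of_mul_bracket_neg [Finite ι] (hu : ¬IsOfFinOrder u) (ht : 0 < t) {c d : kˣ} {j : ι}
    {h : Laurent k ι}
    (hh : h * bracket u t d (Pi.single j 1) = bracket u t c (-Pi.single j 1)) : IsUnit h := by
  rw [← inv_inv c, bracket_neg_neg, ← neg_eq_iff_eq_neg, ← neg_mul] at hh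
  exact (IsUnit.neg_iff h).1 (isUnit_of_mul_bracket hu ht hh)

end Bracket

end WeylHayashi

/-! ### A single factor: universal property and spanning monomials -/

namespace WeylHayashi

section SingleFactor

variable {k : Type*} [Field k] (u : kˣ) (t : ℕ)

/-- The image of a generator in the Weyl-Hayashi algebra. -/
def gen (g : Gen) : WeylHayashiAlgebra k (u : k) t :=
  RingQuot.mkAlgHom k (Rel k (u : k) t) (FreeAlgebra.ι k g)

/-- The invertible element `Ω` of the Weyl-Hayashi algebra. -/
def omega : (WeylHayashiAlgebra k (u : k) t)ˣ where
  val := gen u t Gen.Omega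
  inv := gen u t Gen.OmegaInv
  val_inv := by
    have := RingQuot.mkAlgHom_rel k (Rel.omega_mul_inv (k := k) (q := (u : k)) (t := t))
    rwa [map_mul, map_one] at this
  inv_val := by
    have := RingQuot.mkAlgHom_rel k (Rel.inv_mul_omega (k := k) (q := (u : k)) (t := t))
    rwa [map_mul, map_one] at this

/-- The element `Ψ` of the Weyl-Hayashi algebra. -/
def psi : WeylHayashiAlgebra k (u : k) t := gen u t Gen.Psi

/-- The element `Ψ†` of the Weyl-Hayashi algebra. -/
def psiDag : WeylHayashiAlgebra k (u : k) t := gen u t Gen.PsiDag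

theorem psi_mul_omega : psi u t * omega u t = (u : k) • (omega u t * psi u t) := by
  have := RingQuot.mkAlgHom_rel k (Rel.psi_omega (k := k) (q := (u : k)) (t := t))
  rwa [map_mul, map_smul, map_mul] at this

theorem psiDag_mul_omega :
    psiDag u t * omega u t = ((u⁻¹ : kˣ) : k) • (omega u t * psiDag u t) := by
  have := RingQuot.mkAlgHom_rel k (Rel.psiDag_omega (k := k) (q := (u : k)) (t := t))
  rw [map_mul, map_smul, map_mul, ← Units.val_inv_eq_inv_val] at this
  exact this

theorem psi_mul_psiDag : psi u t * psiDag u t = ((u : k) ^ t - ((u : k) ^ t)⁻¹)⁻¹ •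
    ((u : k) ^ t • (omega u t : WeylHayashiAlgebra k (u : k) t) ^ t -
      ((u : k) ^ t)⁻¹ • (↑(omega u t)⁻¹ : WeylHayashiAlgebra k (u : k) t) ^ t) := by
  have := RingQuot.mkAlgHom_rel k (Rel.psi_psiDag (k := k) (q := (u : k)) (t := t))
  rwa [map_mul, map_smul, map_sub, map_smul, map_smul, map_pow, map_pow] at this

theorem psiDag_mul_psi : psiDag u t * psi u t = ((u : k) ^ t - ((u : k) ^ t)⁻¹)⁻¹ •
    ((omega u t : WeylHayashiAlgebra k (u : k) t) ^ t -
      (↑(omega u t)⁻¹ : WeylHayashiAlgebra k (u : k) t) ^ t) := by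
  have := RingQuot.mkAlgHom_rel k (Rel.psiDag_psi (k := k) (q := (u : k)) (t := t))
  rwa [map_mul, map_smul, map_sub, map_pow, map_pow] at this

variable {u t}

theorem eq_top_of_gen_mem (S : Subalgebra k (WeylHayashiAlgebra k (u : k) t))
    (h : ∀ g, gen u t g ∈ S) : S = ⊤ := by
  rw [eq_top_iff]
  rintro x -
  obtain ⟨y, rfl⟩ := RingQuot.mkAlgHom_surjective k (Rel k (u : k) t) x
  induction y using FreeAlgebra.induction with
  | grade0 r => rw [AlgHom.commutes]; exact S.algebraMap_mem r
  | grade1 g => exact h g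
  | mul a b ha hb => rw [map_mul]; exact S.mul_mem ha hb
  | add a b ha hb => rw [map_add]; exact S.add_mem ha hb

theorem eq_top_of_mem (S : Subalgebra k (WeylHayashiAlgebra k (u : k) t))
    (h1 : ↑(omega u t) ∈ S) (h2 : ↑(omega u t)⁻¹ ∈ S) (h3 : psi u t ∈ S) (h4 : psiDag u t ∈ S) :
    S = ⊤ :=
  eq_top_of_gen_mem S fun g => by
    cases g
    exacts [h1, h2, h3, h4]

variable {B : Type*} [Ring B] [Algebra k B]

/-- The universal property of the Weyl-Hayashi algebra. -/
def liftWH (w : Bˣ) (x y : B) (h1 : x * w = (u : k) • (w * x))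
    (h2 : y * w = ((u⁻¹ : kˣ) : k) • (w * y))
    (h3 : x * y = ((u : k) ^ t - ((u : k) ^ t)⁻¹)⁻¹ •
      ((u : k) ^ t • (w : B) ^ t - ((u : k) ^ t)⁻¹ • (↑w⁻¹ : B) ^ t))
    (h4 : y * x = ((u : k) ^ t - ((u : k) ^ t)⁻¹)⁻¹ • ((w : B) ^ t - (↑w⁻¹ : B) ^ t)) :
    WeylHayashiAlgebra k (u : k) t →ₐ[k] B :=
  RingQuot.liftAlgHom k ⟨FreeAlgebra.lift k (fun g : Gen => match g with
    | .Omega => (w : B)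
    | .OmegaInv => ↑w⁻¹
    | .Psi => x
    | .PsiDag => y), fun a b hab => by
      cases hab <;> simp [Ω, Ωinv, Ψ, Ψdag, h1, h2, h3, h4]⟩

section lift

variable {w : Bˣ} {x y : B} {h1 : x * w = (u : k) • (w * x)}
    {h2 : y * w = ((u⁻¹ : kˣ) : k) • (w * y)}
    {h3 : x * y = ((u : k) ^ t - ((u : k) ^ t)⁻¹)⁻¹ •
      ((u : k) ^ t • (w : B) ^ t - ((u : k) ^ t)⁻¹ • (↑w⁻¹ : B) ^ t)}
    {h4 : y * x = ((u : k) ^ t - ((u : k) ^ t)⁻¹)⁻¹ • ((w : B) ^ t - (↑w⁻¹ : B) ^ t)}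

theorem liftWH_omega : liftWH w x y h1 h2 h3 h4 ↑(omega u t) = w := by
  change liftWH w x y h1 h2 h3 h4 (gen u t Gen.Omega) = ↑w
  simp [liftWH, gen]

theorem liftWH_omega_inv : liftWH w x y h1 h2 h3 h4 ↑(omega u t)⁻¹ = ↑w⁻¹ := by
  change liftWH w x y h1 h2 h3 h4 (gen u t Gen.OmegaInv) = ↑w⁻¹
  simp [liftWH, gen]

theorem liftWH_psi : liftWH w x y h1 h2 h3 h4 (psi u t) = x := by
  simp [liftWH, psi, gen]

theorem liftWH_psiDag : liftWH w x y h1 h2 h3 h4 (psiDag u t) = y := by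
  simp [liftWH, psiDag, gen]

end lift

/-- The centralizer of `z` is a subalgebra, and commuting with a unit implies commuting with its
inverse, so Ω⁻¹ needs no hypothesis. -/
theorem commute_of_commute_gen (f : WeylHayashiAlgebra k (u : k) t →ₐ[k] B) (z : B)
    (h1 : Commute z (f ↑(omega u t))) (h2 : Commute z (f (psi u t)))
    (h3 : Commute z (f (psiDag u t))) (x : WeylHayashiAlgebra k (u : k) t) : Commute z (f x) := by
  have h := eq_top_of_mem ((Subalgebra.centralizer k {z}).comap f) ?_ ?_ ?_ ?_
  · have hx : x ∈ (Subalgebra.centralizer k {z}).comap f := h ▸ Algebra.mem_top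
    exact Subalgebra.mem_centralizer_iff k |>.1 hx z rfl
  all_goals
    rw [Subalgebra.mem_comap, Subalgebra.mem_centralizer_iff]
    intro g hg
    rw [Set.mem_singleton_iff.1 hg]
  · exact h1
  · have : Commute z (Units.map (f : WeylHayashiAlgebra k (u : k) t →* B) (omega u t)) := h1
    exact this.units_inv_right
  · exact h2
  · exact h3

variable (u t)

/-- The powers of `Ψ`, where negative powers are read as powers of `Ψ†`. -/
def psiPow : ℤ → WeylHayashiAlgebra k (u : k) t
  | .ofNat n => psi u t ^ n
  | .negSucc n => psiDag u t ^ (n + 1)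

theorem mul_omega_zpow {x : WeylHayashiAlgebra k (u : k) t} {c : kˣ}
    (h : x * omega u t = (c : k) • (omega u t * x)) (a : ℤ) :
    x * ↑(omega u t ^ a) = ((c ^ a : kˣ) : k) • (↑(omega u t ^ a) * x) := by
  have h' : x * ↑(omega u t)⁻¹ = ((c⁻¹ : kˣ) : k) • (↑(omega u t)⁻¹ * x) := by
    rw [← Units.mul_left_inj (omega u t), Units.inv_mul_cancel_right, smul_mul_assoc, mul_assoc,
      h, mul_smul_comm, Units.inv_mul_cancel_left, smul_smul]
    simp
  induction a with
  | zero => simp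
  | succ n ih =>
    rw [zpow_add_one, Units.val_mul, ← mul_assoc, ih, smul_mul_assoc, mul_assoc, h, mul_smul_comm,
      smul_smul, zpow_add_one, Units.val_mul, mul_assoc]
  | pred n ih =>
    rw [zpow_sub_one, Units.val_mul, ← mul_assoc, ih, smul_mul_assoc, mul_assoc, h', mul_smul_comm,
      smul_smul, zpow_sub_one, Units.val_mul, mul_assoc]

/-- The monomials `Ω^a Ψ^m` span the Weyl-Hayashi algebra. -/
theorem span_omega_zpow_mul_psiPow :
    Submodule.span k (Set.range fun p : ℤ × ℤ =>
      (↑(omega u t ^ p.1) * psiPow u t p.2 : WeylHayashiAlgebra k (u : k) t)) = ⊤ := by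
  set W := Submodule.span k (Set.range fun p : ℤ × ℤ =>
      (↑(omega u t ^ p.1) * psiPow u t p.2 : WeylHayashiAlgebra k (u : k) t))
  have mem (a m : ℤ) : ↑(omega u t ^ a) * psiPow u t m ∈ W := Submodule.subset_span ⟨(a, m), rfl⟩
  -- The left stabilizer of `W` is a subalgebra. Once it contains the generators it is everything,
  -- and applying it to `1 ∈ W` gives `W = ⊤`.
  let S : Subalgebra k (WeylHayashiAlgebra k (u : k) t) :=
    { carrier := {x | ∀ y ∈ W, x * y ∈ W}
      mul_mem' := fun ha hb y hy => by rw [mul_assoc]; exact ha _ (hb _ hy)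
      add_mem' := fun ha hb y hy => by rw [add_mul]; exact W.add_mem (ha _ hy) (hb _ hy)
      algebraMap_mem' := fun r y hy => by rw [← Algebra.smul_def]; exact W.smul_mem _ hy }
  have hS (x) (hx : ∀ a m : ℤ, x * (↑(omega u t ^ a) * psiPow u t m) ∈ W) : x ∈ S := by
    intro y hy
    induction hy using Submodule.span_induction with
    | mem y hy => obtain ⟨p, rfl⟩ := hy; exact hx _ _
    | zero => rw [mul_zero]; exact W.zero_mem
    | add a b _ _ ha hb => rw [mul_add]; exact W.add_mem ha hb
    | smul c a _ ha => rw [mul_smul_comm]; exact W.smul_mem _ ha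
  have hom (b : ℤ) : ↑(omega u t ^ b) ∈ S := hS _ fun a m => by
    rw [← mul_assoc, ← Units.val_mul, ← zpow_add]; exact mem _ _
  have hpow (n : ℕ) : (omega u t : WeylHayashiAlgebra k (u : k) t) ^ n ∈ S := by
    simpa using hom n
  have hpow' (n : ℕ) : (↑(omega u t)⁻¹ : WeylHayashiAlgebra k (u : k) t) ^ n ∈ S := by
    have := hom (-n)
    rw [zpow_neg, zpow_natCast, ← inv_pow, Units.val_pow_eq_pow_val] at this
    exact this
  -- An element that q-commutes with Ω moves past Ω^a at the cost of a scalar, so only its products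
  -- with powers of Ψ and Ψ† remain to be checked.
  have hred {x : WeylHayashiAlgebra k (u : k) t} {c : kˣ}
      (h : x * omega u t = (c : k) • (omega u t * x)) (hx : ∀ m, x * psiPow u t m ∈ W) : x ∈ S :=
    hS _ fun a m => by
      rw [← mul_assoc, mul_omega_zpow u t h, smul_mul_assoc, mul_assoc]
      exact W.smul_mem _ (hom a _ (hx m))
  have hpsi (m) : psiPow u t m ∈ W := by simpa using mem 0 m
  have h1 : psi u t ∈ S := hred (psi_mul_omega u t) fun m => by
    match m with
    | .ofNat n =>
      have := hpsi (.ofNat (n + 1))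
      rwa [psiPow, pow_succ'] at this
    | .negSucc n =>
      rw [psiPow, pow_succ', ← mul_assoc, psi_mul_psiDag]
      refine S.smul_mem (S.sub_mem (S.smul_mem (hpow t) _) (S.smul_mem (hpow' t) _)) _ _ ?_
      cases n with
      | zero => simpa [psiPow] using hpsi 0
      | succ n => exact hpsi (.negSucc n)
  have h2 : psiDag u t ∈ S := hred (psiDag_mul_omega u t) fun m => by
    match m with
    | .ofNat 0 =>
      have := hpsi (.negSucc 0)
      simpa [psiPow] using this
    | .ofNat (n + 1) =>
      rw [psiPow, pow_succ', ← mul_assoc, psiDag_mul_psi]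
      exact S.smul_mem (S.sub_mem (hpow t) (hpow' t)) _ _ (hpsi (.ofNat n))
    | .negSucc n =>
      have := hpsi (.negSucc (n + 1))
      rwa [psiPow, pow_succ'] at this
  have htop := eq_top_of_mem S (by simpa using hom 1) (by simpa using hom (-1)) h1 h2
  rw [eq_top_iff]
  rintro x -
  have hx : x ∈ S := htop ▸ Algebra.mem_top
  have h1W : (1 : WeylHayashiAlgebra k (u : k) t) ∈ W := by simpa [psiPow] using hpsi 0
  simpa using hx 1 h1W

end SingleFactor

end WeylHayashi

/-! ### Graded products and tensor products of algebras -/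

section Graded

variable {M B : Type*} [AddCommGroup M] [Monoid B] {P : M → B → Prop}

/-- `P a x` reads "x has degree a". Keeping `P` abstract serves both degree computations in the
torus and, with all degrees 0, membership in a subalgebra. -/
theorem graded_pow (h1 : P 0 1) (hmul : ∀ {a b x y}, P a x → P b y → P (a + b) (x * y))
    {a : M} {x : B} (h : P a x) (n : ℕ) : P (n • a) (x ^ n) := by
  induction n with
  | zero => simpa using h1
  | succ n ih => rw [succ_nsmul, pow_succ]; exact hmul ih h

theorem graded_zpow (h1 : P 0 1) (hmul : ∀ {a b x y}, P a x → P b y → P (a + b) (x * y))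
    {a : M} {w : Bˣ} (h : P a w) (h' : P (-a) ↑w⁻¹) (n : ℤ) : P (n • a) ↑(w ^ n) := by
  cases n with
  | ofNat n => simpa using graded_pow h1 hmul h n
  | negSucc n =>
    have := graded_pow h1 hmul h' (n + 1)
    rw [zpow_negSucc, negSucc_zsmul, ← inv_pow, Units.val_pow_eq_pow_val]
    simpa only [smul_neg] using this

end Graded

namespace PiTensorProduct

variable {R ι : Type*} [CommSemiring R] [Fintype ι] [DecidableEq ι] {A : ι → Type*}
  [∀ i, Semiring (A i)] [∀ i, Algebra R (A i)] {B : Type*} [Semiring B] [Algebra R B]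

/-- The algebra map out of a tensor product induced by pairwise commuting algebra maps. -/
noncomputable def liftCommuting (f : ∀ i, A i →ₐ[R] B)
    (h : Pairwise fun i j => ∀ x y, Commute (f i x) (f j y)) : (⨂[R] i, A i) →ₐ[R] B :=
  let F : (∀ i, A i) →* B := MonoidHom.noncommPiCoprod (fun i => (f i : A i →* B)) h
  -- Pulling the i-th factor to the front reduces multilinearity of the product to linearity of `f
  -- i`.
  have hF : ∀ [DecidableEq ι] (x : ∀ i, A i) (i : ι) (a : A i), F (Function.update x i a) = f i a *
      F (Function.update x i 1) := by
    intro _ x i a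
    have h1 : Function.update x i a = Pi.mulSingle i a * Function.update x i 1 := by
      ext j
      by_cases hj : j = i
      · subst hj; simp
      · simp [hj]
    rw [h1, map_mul]
    exact congrArg (· * _) (MonoidHom.noncommPiCoprod_mulSingle _ i a)
  liftAlgHom
    { toFun := F
      map_update_add' := fun x i a b => by
        rw [hF x i (a + b), hF x i a,
          hF x i b, map_add, add_mul]
      map_update_smul' := fun x i c a => by
        rw [hF x i (c • a), hF x i a,
          map_smul, smul_mul_assoc] }
    (map_one F) (map_mul F)

theorem liftCommuting_single (f : ∀ i, A i →ₐ[R] B)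
    (h : Pairwise fun i j => ∀ x y, Commute (f i x) (f j y)) (i : ι) (a : A i) :
    liftCommuting f h (singleAlgHom i a) = f i a := by
  simp only [liftCommuting, singleAlgHom_apply, liftAlgHom_apply, lift.tprod]
  exact MonoidHom.noncommPiCoprod_mulSingle (fun i => (f i : A i →* B)) (hcomm := h) i a

/-- A pure tensor is the product of its one-slot tensors; the induction fills the slots one at a
time, starting from 1. -/
theorem tprod_graded {M : Type*} [AddCommMonoid M] {P : M → (⨂[R] i, A i) → Prop} (h1 : P 0 1)
    (hmul : ∀ {a b x y}, P a x → P b y → P (a + b) (x * y)) {d : ι → M} {x : ∀ i, A i}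
    (h : ∀ i, P (d i) (singleAlgHom i (x i))) : P (∑ i, d i) (tprod R x) := by
  have key : ∀ s : Finset ι,
      P (∑ i ∈ s, d i) (tprod R fun i => if i ∈ s then x i else 1) := by
    intro s
    induction s using Finset.induction_on with
    | empty => simp only [Finset.sum_empty, Finset.notMem_empty, if_false]; exact h1
    | insert i s hi ih =>
      rw [Finset.sum_insert hi]
      have : (tprod R fun j => if j ∈ insert i s then x j else 1) =
          singleAlgHom i (x i) * tprod R fun j => if j ∈ s then x j else 1 := by
        rw [singleAlgHom_apply, tprod_mul_tprod]
        congr 1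
        ext j
        by_cases hj : j = i
        · subst hj; simp [hi]
        · simp [hj]
      rw [this]
      exact hmul (h i) ih
  simpa using key Finset.univ

theorem span_tprod_eq_top_of_span {κ : ι → Type*} (e : ∀ i, κ i → A i)
    (he : ∀ i, Submodule.span R (Set.range (e i)) = ⊤) :
    Submodule.span R (Set.range fun p : ∀ i, κ i => tprod R fun i => e i (p i)) = ⊤ := by
  rw [eq_top_iff, ← span_tprod_eq_top, Submodule.span_le]
  rintro _ ⟨x, rfl⟩
  have hx : ∀ i, ∃ l : κ i →₀ R, l.sum (fun j c => c • e i j) = x i := fun i =>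
    (Finsupp.mem_span_range_iff_exists_finsupp).1 (he i ▸ Submodule.mem_top)
  choose l hl using hx
  have : x = fun i => ∑ j ∈ (l i).support, l i j • e i j := funext fun i => (hl i).symm
  rw [this, MultilinearMap.map_sum_finset]
  refine Submodule.sum_mem _ fun r _ => ?_
  rw [MultilinearMap.map_smul_univ]
  exact Submodule.smul_mem _ _ (Submodule.subset_span ⟨r, rfl⟩)

end PiTensorProduct

/-! ### The representation in the torus -/

namespace WeylHayashi

open PiTensorProduct

variable {k ι : Type*} [Field k] [Fintype ι] [DecidableEq ι] (u : kˣ) (t : ℕ)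

section Representation

theorem mono_zero_pow (r : Laurent k ι) (n : ℕ) : mono u 0 r ^ n = mono u 0 (r ^ n) := by
  induction n with
  | zero => rw [pow_zero, pow_zero, one_eq_mono]
  | succ n ih =>
    rw [pow_succ, ih, mono_mul_mono, add_zero, shift_zero, AlgHom.id_apply, pow_succ]

/-- The monomial `c ω^a` as a unit of the torus. -/
noncomputable def monoUnit (a : ι → ℤ) (c : kˣ) : (Torus u ι)ˣ where
  val := mono u 0 (AddMonoidAlgebra.single a (c : k))
  inv := mono u 0 (AddMonoidAlgebra.single (-a) ((c⁻¹ : kˣ) : k))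
  val_inv := by
    rw [mono_mul_mono, shift_single, AddMonoidAlgebra.single_mul_single, one_eq_mono,
      AddMonoidAlgebra.one_def]
    simp
  inv_val := by
    rw [mono_mul_mono, shift_single, AddMonoidAlgebra.single_mul_single, one_eq_mono,
      AddMonoidAlgebra.one_def]
    simp

theorem monoUnit_val (a : ι → ℤ) (c : kˣ) :
    (monoUnit u a c : Torus u ι) = mono u 0 (AddMonoidAlgebra.single a (c : k)) := rfl

theorem monoUnit_inv (a : ι → ℤ) (c : kˣ) : (↑(monoUnit u a c)⁻¹ : Torus u ι) =
    mono u 0 (AddMonoidAlgebra.single (-a) ((c⁻¹ : kˣ) : k)) := rfl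

theorem smul_monoUnit_pow_sub (a : ι → ℤ) (c : kˣ) :
    ((u : k) ^ t - ((u : k) ^ t)⁻¹)⁻¹ •
      ((monoUnit u a c : Torus u ι) ^ t - (↑(monoUnit u a c)⁻¹ : Torus u ι) ^ t) =
    mono u 0 (bracket u t c a) := by
  rw [monoUnit_val, monoUnit_inv, mono_zero_pow, mono_zero_pow, ← mono_sub, smul_mono,
    AddMonoidAlgebra.single_pow, AddMonoidAlgebra.single_pow, bracket]
  simp

theorem smul_smul_monoUnit_pow_sub (a : ι → ℤ) (c : kˣ) :
    ((u : k) ^ t - ((u : k) ^ t)⁻¹)⁻¹ • ((u : k) ^ t • (monoUnit u a c : Torus u ι) ^ t -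
      ((u : k) ^ t)⁻¹ • (↑(monoUnit u a c)⁻¹ : Torus u ι) ^ t) =
    mono u 0 (bracket u t (u * c) a) := by
  rw [monoUnit_val, monoUnit_inv, mono_zero_pow, mono_zero_pow, smul_mono, smul_mono, ← mono_sub,
    smul_mono, AddMonoidAlgebra.single_pow, AddMonoidAlgebra.single_pow, bracket,
    AddMonoidAlgebra.smul_single, AddMonoidAlgebra.smul_single]
  simp [mul_pow, mul_comm]

/-- The embedding of the `j`-th tensor factor in the torus. -/
noncomputable def factorRep (j : ι) : WeylHayashiAlgebra k (u : k) t →ₐ[k] Torus u ι :=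
  liftWH (monoUnit u (Pi.single j 1) 1) (mono u (Pi.single j 1) 1)
    (mono u (-Pi.single j 1) (bracket u t 1 (Pi.single j 1)))
    (by
      rw [monoUnit_val, mono_mul_mono, mono_mul_mono, smul_mono, shift_single]
      simp)
    (by
      rw [monoUnit_val, mono_mul_mono, mono_mul_mono, smul_mono, shift_single, shift_zero, add_zero,
        zero_add, AlgHom.id_apply, mul_comm, ← smul_mul_assoc, AddMonoidAlgebra.smul_single]
      simp)
    (by
      rw [smul_smul_monoUnit_pow_sub, mono_mul_mono, add_neg_cancel, shift_bracket]
      simp)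
    (by
      rw [smul_monoUnit_pow_sub, mono_mul_mono, neg_add_cancel, map_one, mul_one])

theorem factorRep_omega (j : ι) : factorRep u t j ↑(omega u t) =
    mono u 0 (AddMonoidAlgebra.single (Pi.single j 1) 1) := liftWH_omega

theorem factorRep_psi (j : ι) : factorRep u t j (psi u t) = mono u (Pi.single j 1) 1 := liftWH_psi

theorem factorRep_psiDag (j : ι) : factorRep u t j (psiDag u t) =
    mono u (-Pi.single j 1) (bracket u t 1 (Pi.single j 1)) := liftWH_psiDag

theorem commute_mono {m l : ι → ℤ} {r s : Laurent k ι} (h1 : shift u m s = s)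
    (h2 : shift u l r = r) : Commute (mono u m r) (mono u l s) := by
  rw [Commute, SemiconjBy, mono_mul_mono, mono_mul_mono, h1, h2, add_comm, mul_comm]

theorem shift_single_single_of_ne {i j : ι} (hij : i ≠ j) (z w : ℤ) (c : k) :
    shift u (Pi.single j z) (AddMonoidAlgebra.single (Pi.single i w) c) =
      AddMonoidAlgebra.single (Pi.single i w) c := by
  simp [hij]

theorem shift_single_bracket_of_ne {i j : ι} (hij : i ≠ j) (z : ℤ) (c : kˣ) :
    shift u (Pi.single j z) (bracket u t c (Pi.single i 1)) = bracket u t c (Pi.single i 1) := by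
  simp [shift_bracket, hij]

theorem commute_factorRep : Pairwise fun i j : ι => ∀ x y : WeylHayashiAlgebra k (u : k) t,
    Commute (factorRep u t i x) (factorRep u t j y) := by
  intro i j hij x y
  -- `Q i` describes elements living in direction `i` only: their coefficient is fixed by shifts in
  -- other directions. Such elements commute for distinct indices.
  let Q (i : ι) (x : Torus u ι) : Prop := ∃ z r, x = mono u (Pi.single i z) r ∧
    ∀ j, i ≠ j → ∀ z', shift u (Pi.single j z') r = r
  have h1 (i : ι) : Q i (factorRep u t i ↑(omega u t)) :=
    ⟨0, AddMonoidAlgebra.single (Pi.single i 1) 1, by rw [factorRep_omega, Pi.single_zero], fun j hj z => shift_single_single_of_ne u hj ..⟩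
  have h2 (i : ι) : Q i (factorRep u t i (psi u t)) :=
    ⟨1, _, factorRep_psi u t i, fun j hj z => map_one _⟩
  have h3 (i : ι) : Q i (factorRep u t i (psiDag u t)) :=
    ⟨-1, _, by rw [factorRep_psiDag, Pi.single_neg], fun j hj z =>
      shift_single_bracket_of_ne u t hj ..⟩
  have hQ {x y : Torus u ι} (hx : Q i x) (hy : Q j y) : Commute x y := by
    obtain ⟨z, r, rfl, hr⟩ := hx
    obtain ⟨w, s, rfl, hs⟩ := hy
    exact commute_mono u (hs i hij.symm z) (hr j hij w)
  have hy {x : Torus u ι} (hx : Q i x) : Commute (factorRep u t j y) x :=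
    (commute_of_commute_gen (factorRep u t j) x (hQ hx (h1 j)) (hQ hx (h2 j))
      (hQ hx (h3 j)) y).symm
  exact (commute_of_commute_gen (factorRep u t i) _ (hy (h1 i)) (hy (h2 i)) (hy (h3 i)) x).symm

/-- The embedding of the tensor power in the torus. -/
noncomputable def rep : (⨂[k] _ : ι, WeylHayashiAlgebra k (u : k) t) →ₐ[k] Torus u ι :=
  liftCommuting (factorRep u t) (commute_factorRep u t)

theorem rep_single (i : ι) (x : WeylHayashiAlgebra k (u : k) t) :
    rep u t (singleAlgHom i x) = factorRep u t i x :=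
  liftCommuting_single _ _ _ _

end Representation

/-! ### Monomials and the injectivity criterion -/

section Monomials

variable {u t}

theorem eq_top_of_single_mem (S : Subalgebra k (⨂[k] _ : ι, WeylHayashiAlgebra k (u : k) t))
    (h : ∀ i x, singleAlgHom i x ∈ S) : S = ⊤ := by
  have h' : ∀ x, PiTensorProduct.tprod k x ∈ S := fun x =>
    tprod_graded (M := ℤ) (P := fun _ y => y ∈ S) (d := 0) S.one_mem (fun ha hb => S.mul_mem ha hb)
      fun i => h i (x i)
  rw [eq_top_iff]
  rintro x -
  have : x ∈ Submodule.span k (Set.range (PiTensorProduct.tprod k)) := by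
    rw [span_tprod_eq_top]
    exact Submodule.mem_top
  refine (Submodule.span_le (p := Subalgebra.toSubmodule S)).2 ?_ this
  rintro _ ⟨x, rfl⟩
  exact h' x

variable (u t)

/-- The monomial `∏ Ω_i^{a_i}`. -/
noncomputable def omegaMon (a : ι → ℤ) : ⨂[k] _ : ι, WeylHayashiAlgebra k (u : k) t :=
  PiTensorProduct.tprod k fun i => ↑(omega u t ^ a i)

/-- The monomial `∏ Ψ_i^{m_i}`. -/
noncomputable def psiMon (m : ι → ℤ) : ⨂[k] _ : ι, WeylHayashiAlgebra k (u : k) t :=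
  PiTensorProduct.tprod k fun i => psiPow u t (m i)

theorem span_omegaMon_mul_psiMon :
    Submodule.span k (Set.range fun p : (_ : ι → ℤ) × (ι → ℤ) =>
      omegaMon u t p.2 * psiMon u t p.1) = ⊤ := by
  let e : ι → ℤ × ℤ → WeylHayashiAlgebra k (u : k) t :=
    fun _ p => ↑(omega u t ^ p.1) * psiPow u t p.2
  have he : ∀ i : ι, Submodule.span k (Set.range (e i)) = ⊤ :=
    fun _ => span_omega_zpow_mul_psiPow u t
  have h := span_tprod_eq_top_of_span e he
  rw [eq_top_iff, ← h]
  refine Submodule.span_mono ?_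
  rintro _ ⟨p, rfl⟩
  refine ⟨⟨fun i => (p i).2, fun i => (p i).1⟩, ?_⟩
  simp only [omegaMon, psiMon, tprod_mul_tprod]
  rfl

variable {u t}

theorem omegaMon_mem (S : Subalgebra k (⨂[k] _ : ι, WeylHayashiAlgebra k (u : k) t))
    (h : ∀ i, singleAlgHom i ↑(omega u t) ∈ S) (h' : ∀ i, singleAlgHom i ↑(omega u t)⁻¹ ∈ S)
    (a : ι → ℤ) : omegaMon u t a ∈ S :=
  tprod_graded (M := ℤ) (P := fun _ y => y ∈ S) (d := 0) S.one_mem (fun ha hb => S.mul_mem ha hb)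
    fun i => graded_zpow (M := ℤ) (P := fun _ y => singleAlgHom i y ∈ S) (a := 0)
      (by simp only [map_one]; exact S.one_mem)
      (fun ha hb => by simp only [map_mul]; exact S.mul_mem ha hb) (h i) (h' i) (a i)

/-- Images of monomials under a homomorphism to the torus mapping each `Ω_i` to a monomial. -/
theorem exists_map_omegaMon (θ : (⨂[k] _ : ι, WeylHayashiAlgebra k (u : k) t) →ₐ[k] Torus u ι)
    (Γ : Subgroup kˣ) {α : ι → ι → ℤ} (hα : ∀ i, ∃ c ∈ Γ, θ (singleAlgHom i ↑(omega u t)) =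
      mono u 0 (AddMonoidAlgebra.single (α i) (c : k))) (a : ι → ℤ) :
    ∃ c ∈ Γ, θ (omegaMon u t a) =
      mono u 0 (AddMonoidAlgebra.single (∑ i, a i • α i) (c : k)) := by
  have h1 : ∃ c ∈ Γ, θ 1 = mono u 0 (AddMonoidAlgebra.single 0 (c : k)) :=
    ⟨1, Γ.one_mem, by rw [map_one, one_eq_mono, AddMonoidAlgebra.one_def, Units.val_one]⟩
  have hmul : ∀ {a b x y},
      (∃ c ∈ Γ, θ x = mono u 0 (AddMonoidAlgebra.single a (c : k))) →
      (∃ c ∈ Γ, θ y = mono u 0 (AddMonoidAlgebra.single b (c : k))) →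
      ∃ c ∈ Γ, θ (x * y) = mono u 0 (AddMonoidAlgebra.single (a + b) (c : k)) := by
    rintro a b x y ⟨c, hc, hx⟩ ⟨d, hd, hy⟩
    refine ⟨c * d, Γ.mul_mem hc hd, ?_⟩
    rw [map_mul, hx, hy, mono_mul_mono, add_zero, shift_zero, AlgHom.id_apply,
      AddMonoidAlgebra.single_mul_single, Units.val_mul]
  refine tprod_graded (P := fun a x =>
    ∃ c ∈ Γ, θ x = mono u 0 (AddMonoidAlgebra.single a (c : k))) h1 hmul fun i => ?_
  refine graded_zpow (P := fun a x =>
    ∃ c ∈ Γ, θ (singleAlgHom i x) = mono u 0 (AddMonoidAlgebra.single a (c : k)))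
    (by rwa [map_one]) (fun ha hb => by rw [map_mul]; exact hmul ha hb) (hα i) ?_ (a i)
  obtain ⟨c, hc, h⟩ := hα i
  refine ⟨c⁻¹, Γ.inv_mem hc, ?_⟩
  rw [← monoUnit_val] at h
  rw [← monoUnit_inv]
  refine (Units.inv_eq_of_mul_eq_one_left ?_).symm
  rw [← h, ← map_mul, ← map_mul, Units.inv_mul, map_one, map_one]

/-- Degrees add, and coefficients stay nonzero because Laurent polynomials form a domain and shifts
are injective. Negative powers are powers of Ψ†, whose degree is opposite. -/
theorem exists_map_psiMon (θ : (⨂[k] _ : ι, WeylHayashiAlgebra k (u : k) t) →ₐ[k] Torus u ι)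
    {μ : ι → ι → ℤ} (h : ∀ i, ∃ F, F ≠ 0 ∧ θ (singleAlgHom i (psi u t)) = mono u (μ i) F)
    (h' : ∀ i, ∃ F, F ≠ 0 ∧ θ (singleAlgHom i (psiDag u t)) = mono u (-μ i) F) (m : ι → ℤ) :
    ∃ F, F ≠ 0 ∧ θ (psiMon u t m) = mono u (∑ i, m i • μ i) F := by
  have h1 : ∃ F, F ≠ 0 ∧ θ 1 = mono u 0 F := ⟨1, one_ne_zero, by rw [map_one, one_eq_mono]⟩
  have hmul : ∀ {a b x y}, (∃ F, F ≠ 0 ∧ θ x = mono u a F) → (∃ F, F ≠ 0 ∧ θ y = mono u b F) →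
      ∃ F, F ≠ 0 ∧ θ (x * y) = mono u (a + b) F := by
    rintro a b x y ⟨F, hF, hx⟩ ⟨G, hG, hy⟩
    refine ⟨F * shift u a G, mul_ne_zero hF ?_, by rw [map_mul, hx, hy, mono_mul_mono]⟩
    intro h0
    apply hG
    rw [← AlgHom.id_apply (R := k) G, ← shift_zero u, ← neg_add_cancel a, shift_add,
      AlgHom.comp_apply, h0, map_zero]
  refine tprod_graded (P := fun a x => ∃ F, F ≠ 0 ∧ θ x = mono u a F) h1 hmul fun i => ?_
  have h1' : ∃ F, F ≠ 0 ∧ θ (singleAlgHom i 1) = mono u 0 F := by rwa [map_one]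
  have hmul' : ∀ {a b x y}, (∃ F, F ≠ 0 ∧ θ (singleAlgHom i x) = mono u a F) →
      (∃ F, F ≠ 0 ∧ θ (singleAlgHom i y) = mono u b F) →
      ∃ F, F ≠ 0 ∧ θ (singleAlgHom i (x * y)) = mono u (a + b) F := fun ha hb => by
    rw [map_mul]; exact hmul ha hb
  cases hm : m i with
  | ofNat n =>
    have := graded_pow (P := fun a x => ∃ F, F ≠ 0 ∧ θ (singleAlgHom i x) = mono u a F)
      h1' hmul' (h i) n
    simpa [psiPow] using this
  | negSucc n =>
    have := graded_pow (P := fun a x => ∃ F, F ≠ 0 ∧ θ (singleAlgHom i x) = mono u a F)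
      h1' hmul' (h' i) (n + 1)
    rw [negSucc_zsmul, ← smul_neg]
    exact this

/-- A homomorphism to the torus sending generators to homogeneous elements of independent degrees
is injective. -/
theorem injective_of_graded (θ : (⨂[k] _ : ι, WeylHayashiAlgebra k (u : k) t) →ₐ[k] Torus u ι)
    {α μ : ι → ι → ℤ} (hα : ∀ i, ∃ c : kˣ, θ (singleAlgHom i ↑(omega u t)) =
      mono u 0 (AddMonoidAlgebra.single (α i) (c : k)))
    (h : ∀ i, ∃ F, F ≠ 0 ∧ θ (singleAlgHom i (psi u t)) = mono u (μ i) F)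
    (h' : ∀ i, ∃ F, F ≠ 0 ∧ θ (singleAlgHom i (psiDag u t)) = mono u (-μ i) F)
    (hαinj : Function.Injective fun a : ι → ℤ => ∑ i, a i • α i)
    (hμinj : Function.Injective fun m : ι → ℤ => ∑ i, m i • μ i) : Function.Injective θ := by
  choose c _ hc using exists_map_omegaMon θ ⊤ (α := α) fun i =>
    (hα i).imp fun c hc => ⟨Subgroup.mem_top c, hc⟩
  choose F hF hF' using exists_map_psiMon θ h h'
  -- Within one degree, distinct Laurent monomials are multiplied by the same nonzero `F m`.
  have hind : ∀ m, LinearIndependent k fun a : ι → ℤ =>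
      AddMonoidAlgebra.single (∑ i, a i • α i) (c a : k) * F m := by
    intro m
    have h1 : LinearIndependent k fun a : ι → ℤ =>
        (AddMonoidAlgebra.single (∑ i, a i • α i) (1 : k) : Laurent k ι) := by
      have h2 := (Finsupp.basisSingleOne (R := k) (ι := ι → ℤ)).linearIndependent.comp _ hαinj
      have h3 := h2.map' (AddMonoidAlgebra.coeffLinearEquiv k).symm.toLinearMap
        (LinearEquiv.ker _)
      have h4 : (fun a : ι → ℤ =>
          (AddMonoidAlgebra.single (∑ i, a i • α i) (1 : k) : Laurent k ι)) =
          (AddMonoidAlgebra.coeffLinearEquiv k).symm.toLinearMap ∘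
            Finsupp.basisSingleOne ∘ fun a : ι → ℤ => ∑ i, a i • α i := by
        funext a
        simp
      rw [h4]
      exact h3
    have h4 := (h1.units_smul c).map' (LinearMap.mulRight k (F m))
      (LinearMap.ker_eq_bot.2 (mul_left_injective₀ (hF m)))
    have h5 : (fun a : ι → ℤ => AddMonoidAlgebra.single (∑ i, a i • α i) (c a : k) * F m) =
        LinearMap.mulRight k (F m) ∘ (c • fun a : ι → ℤ =>
          (AddMonoidAlgebra.single (∑ i, a i • α i) (1 : k) : Laurent k ι)) := by
      funext a
      simp [Units.smul_def]
    rw [h5]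
    exact h4
  have hli := linearIndependent_mono u hμinj hind
  have heq : (fun p : (_ : ι → ℤ) × (ι → ℤ) => θ (omegaMon u t p.2 * psiMon u t p.1)) = fun p =>
      mono u (∑ i, p.1 i • μ i)
        (AddMonoidAlgebra.single (∑ i, p.2 i • α i) (c p.2 : k) * F p.1) := by
    funext p
    rw [map_mul, hc, hF', mono_mul_mono, zero_add, shift_zero, AlgHom.id_apply]
  rw [← heq] at hli
  rw [injective_iff_map_eq_zero]
  intro x hx
  obtain ⟨l, rfl⟩ := (Finsupp.mem_span_range_iff_exists_finsupp).1
    (span_omegaMon_mul_psiMon (ι := ι) u t ▸ Submodule.mem_top (x := x))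
  have hl : l = 0 := by
    refine linearIndependent_iff.1 hli l ?_
    rw [Finsupp.linearCombination_apply, ← hx, map_finsuppSum]
    simp
  rw [hl, Finsupp.sum_zero_index]

end Monomials

end WeylHayashi

/-! ### The image of the embedding: divisibility, units, weights -/

namespace WeylHayashi

open PiTensorProduct

variable {k ι : Type*} [Field k] [Fintype ι] [DecidableEq ι] {u : kˣ} {t : ℕ}

section Embedding

theorem sum_smul_single_one (a : ι → ℤ) : ∑ i, a i • (Pi.single i 1 : ι → ℤ) = a := by
  simp_rw [← Pi.single_smul, smul_eq_mul, mul_one]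
  exact Finset.univ_sum_single a

theorem rep_omega (j : ι) : rep u t (singleAlgHom j ↑(omega u t)) =
    mono u 0 (AddMonoidAlgebra.single (Pi.single j 1) 1) := by
  rw [rep_single, factorRep_omega]

theorem rep_omega_inv (j : ι) : rep u t (singleAlgHom j ↑(omega u t)⁻¹) =
    mono u 0 (AddMonoidAlgebra.single (-Pi.single j 1) 1) := by
  rw [rep_single, factorRep, liftWH_omega_inv, monoUnit_inv, inv_one, Units.val_one]

theorem rep_psi (j : ι) : rep u t (singleAlgHom j (psi u t)) = mono u (Pi.single j 1) 1 := by
  rw [rep_single, factorRep_psi]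

theorem rep_psiDag (j : ι) : rep u t (singleAlgHom j (psiDag u t)) =
    mono u (-Pi.single j 1) (bracket u t 1 (Pi.single j 1)) := by
  rw [rep_single, factorRep_psiDag]

theorem rep_omegaMon (a : ι → ℤ) :
    rep u t (omegaMon u t a) = mono u 0 (AddMonoidAlgebra.single a 1) := by
  -- The subgroup records where the scalars lie; the trivial one pins the scalar to 1.
  obtain ⟨c, hc, h⟩ := exists_map_omegaMon (rep u t) ⊥ (α := fun i => Pi.single i 1)
    (fun i => ⟨1, rfl, rep_omega i⟩) a
  rw [h, Subgroup.mem_bot.1 hc, sum_smul_single_one, Units.val_one]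

theorem exists_rep_psiMon (hu : ¬IsOfFinOrder u) (ht : 0 < t) (m : ι → ℤ) :
    ∃ F, rep u t (psiMon u t m) = mono u m F := by
  obtain ⟨F, -, h⟩ := exists_map_psiMon (rep u t) (μ := fun i => Pi.single i 1)
    (fun i => ⟨1, one_ne_zero, rep_psi i⟩)
    (fun i => ⟨_, bracket_ne_zero hu ht _ (by simp), rep_psiDag i⟩) m
  exact ⟨F, by rw [h, sum_smul_single_one]⟩

theorem rep_injective (hu : ¬IsOfFinOrder u) (ht : 0 < t) :
    Function.Injective (rep (ι := ι) u t) := by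
  have hinj : Function.Injective fun a : ι → ℤ => ∑ i, a i • (Pi.single i 1 : ι → ℤ) := by
    simp_rw [sum_smul_single_one]
    exact Function.injective_id
  exact injective_of_graded (rep u t) (fun i => ⟨1, rep_omega i⟩)
    (fun i => ⟨1, one_ne_zero, rep_psi i⟩)
    (fun i => ⟨_, bracket_ne_zero hu ht _ (by simp), rep_psiDag i⟩) hinj hinj

theorem psiPow_of_neg {z : ℤ} (hz : z < 0) :
    psiPow u t z = psiDag u t * psiPow u t (z + 1) := by
  match z with
  | .ofNat n => exact absurd hz (by simp)
  | .negSucc 0 => simp [psiPow]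
  | .negSucc (n + 1) => exact pow_succ' _ _

/-- Components of negative degree of elements of the tensor power are divisible by brackets. -/
theorem bracket_dvd_comp_rep (hu : ¬IsOfFinOrder u) (ht : 0 < t)
    (x : ⨂[k] _ : ι, WeylHayashiAlgebra k (u : k) t) {m : ι → ℤ} {j : ι} (hm : m j < 0) :
    bracket u t 1 (Pi.single j 1) ∣ comp u m (rep u t x) := by
  have hx : x ∈ Submodule.span k (Set.range fun p : (_ : ι → ℤ) × (ι → ℤ) =>
      omegaMon u t p.2 * psiMon u t p.1) := by
    rw [span_omegaMon_mul_psiMon]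
    exact Submodule.mem_top
  induction hx using Submodule.span_induction with
  | zero => rw [map_zero, map_zero]; exact dvd_zero _
  | add x y _ _ hx hy => rw [map_add, map_add]; exact dvd_add hx hy
  | smul c x _ hx =>
    rw [map_smul, map_smul, Algebra.smul_def]
    exact hx.mul_left _
  | mem x hx =>
    obtain ⟨⟨l, a⟩, rfl⟩ := hx
    simp only
    rw [map_mul, rep_omegaMon, comp_mono_mul, shift_zero, sub_zero, AlgHom.id_apply]
    refine Dvd.dvd.mul_left ?_ _
    by_cases hl : l = m
    · subst hl
      -- Since `l j < 0`, a factor Ψ†_j splits off on the left, and its left coefficient is the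
      -- bracket.
      have : psiMon u t l = singleAlgHom j (psiDag u t) * psiMon u t (l + Pi.single j 1) := by
        rw [singleAlgHom_apply, psiMon, psiMon, tprod_mul_tprod]
        congr 1
        ext i
        by_cases hi : i = j
        · subst hi
          simp [psiPow_of_neg hm]
        · simp [hi]
      rw [this, map_mul, rep_psiDag, comp_mono_mul]
      exact dvd_mul_right _ _
    · obtain ⟨F, hF⟩ := exists_rep_psiMon (ι := ι) hu ht l
      rw [hF, comp_mono_of_ne u hl]
      exact dvd_zero _

/-- The unit and its inverse have opposite degrees and unit coefficients. If the degree were nonzero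
in direction j, one of the two would be negative there, so a non-unit bracket would divide a unit.
-/
theorem exists_rep_unit (hu : ¬IsOfFinOrder u) (ht : 0 < t)
    (w : (⨂[k] _ : ι, WeylHayashiAlgebra k (u : k) t)ˣ) :
    ∃ (a : ι → ℤ) (c : kˣ), rep u t w = (monoUnit u a c : Torus u ι) ∧
      rep (ι := ι) u t ↑w⁻¹ = (↑(monoUnit u a c)⁻¹ : Torus u ι) := by
  have h1 : rep u t w * rep (ι := ι) u t ↑w⁻¹ = 1 := by rw [← map_mul, Units.mul_inv, map_one]
  have h2 : rep (ι := ι) u t ↑w⁻¹ * rep u t w = 1 := by rw [← map_mul, Units.inv_mul, map_one]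
  obtain ⟨m, r, hr, hw⟩ := exists_eq_mono_of_mul_eq_one u h1
  obtain ⟨l, s, hs, hw'⟩ := exists_eq_mono_of_mul_eq_one u h2
  rw [hw, hw', mono_mul_mono, one_eq_mono] at h1
  have hml : m + l = 0 := by
    by_contra hne
    have := congrArg (comp u 0) h1
    rw [comp_mono_of_ne u hne, comp_mono_self] at this
    exact zero_ne_one this
  obtain rfl : l = -m := (neg_eq_of_add_eq_zero_right hml).symm
  rw [hml] at h1
  have h3 := mono_injective u 0 h1
  have hur : IsUnit r := IsUnit.of_mul_eq_one _ h3
  have hus : IsUnit s := isUnit_of_isUnit_shift u (IsUnit.of_mul_eq_one _ ((mul_comm _ _).trans h3))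
  have hm : m = 0 := by
    funext j
    by_contra hne
    rcases lt_or_gt_of_ne hne with hj | hj
    · have := bracket_dvd_comp_rep hu ht (w : ⨂[k] _ : ι, WeylHayashiAlgebra k (u : k) t) hj
      rw [hw, comp_mono_self] at this
      exact not_isUnit_bracket _ _ (isUnit_of_dvd_unit this hur)
    · have := bracket_dvd_comp_rep hu ht (↑w⁻¹ : ⨂[k] _ : ι, WeylHayashiAlgebra k (u : k) t)
        (m := -m) (j := j) (by simpa using hj)
      rw [hw', comp_mono_self] at this
      exact not_isUnit_bracket _ _ (isUnit_of_dvd_unit this hus)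
  subst hm
  obtain ⟨a, c, rfl⟩ := isUnit_laurent_iff.1 hur
  refine ⟨a, c, hw, ?_⟩
  refine (Units.inv_eq_of_mul_eq_one_left ?_).symm
  rw [monoUnit_val, ← hw, ← map_mul, Units.inv_mul, map_one]

/-- In degree m, moving ω^a past X^m costs u^{m·a}, so u^{m·a} = u^e; infinite order of `u` compares
exponents. -/
theorem weight_eq (hu : ¬IsOfFinOrder u) {x : Torus u ι} {a : ι → ℤ} {c : kˣ} {e : ℤ}
    (h : x * monoUnit u a c = ((u ^ e : kˣ) : k) • (monoUnit u a c * x)) {m : ι → ℤ}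
    (hm : comp u m x ≠ 0) : m ⬝ᵥ a = e := by
  have h1 := congrArg (comp u m) h
  rw [monoUnit_val, comp_mul_mono, map_smul, comp_mono_mul, sub_zero, shift_zero, AlgHom.id_apply,
    mul_comm, ← smul_mul_assoc, shift_single, AddMonoidAlgebra.smul_single] at h1
  have h2 := congrArg (fun f => AddMonoidAlgebra.coeff f a) (mul_right_cancel₀ hm h1)
  simp only [AddMonoidAlgebra.coeff_single, Finsupp.single_eq_same, smul_eq_mul] at h2
  rw [mul_comm, ← Units.val_mul, ← Units.val_mul, Units.val_inj, mul_left_inj] at h2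
  exact (injective_zpow_iff_not_isOfFinOrder.2 hu) h2

theorem eq_mono_of_comp_eq_zero {x : Torus u ι} {m : ι → ℤ}
    (h : ∀ l, comp u l x ≠ 0 → l = m) : x = mono u m (comp u m x) := by
  refine torus_ext u fun l => ?_
  by_cases hl : m = l
  · subst hl; rw [comp_mono_self]
  · rw [comp_mono_of_ne u hl]
    by_contra hne
    exact hl (h l hne).symm

theorem mem_of_rep_eq (hu : ¬IsOfFinOrder u) (ht : 0 < t)
    {S : Subalgebra k (⨂[k] _ : ι, WeylHayashiAlgebra k (u : k) t)}
    (hS : ∀ a, omegaMon u t a ∈ S) {x y : ⨂[k] _ : ι, WeylHayashiAlgebra k (u : k) t}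
    {m : ι → ℤ} {r s : Laurent k ι} (hr : IsUnit r) (hx : rep u t x = mono u m (s * r))
    (hy : rep u t y = mono u m s) (hxS : x ∈ S) : y ∈ S := by
  obtain ⟨b, d, rfl⟩ := isUnit_laurent_iff.1 hr
  have : y = ((d⁻¹ : kˣ) : k) • (omegaMon u t (-b) * x) := by
    apply rep_injective hu ht
    rw [map_smul, map_mul, hx, hy, rep_omegaMon, mono_mul_mono, zero_add, shift_zero,
      AlgHom.id_apply, smul_mono, mul_comm s, ← mul_assoc, AddMonoidAlgebra.single_mul_single,
      ← smul_mul_assoc, AddMonoidAlgebra.smul_single]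
    simp [← AddMonoidAlgebra.one_def]
  rw [this]
  exact S.smul_mem (S.mul_mem (hS _) hxS) _

end Embedding

end WeylHayashi

/-! ### Degrees of a homomorphism to the torus -/

namespace WeylHayashi

open PiTensorProduct

variable {k ι : Type*} [Field k] [Fintype ι] [DecidableEq ι] {u : kˣ} {t : ℕ}

section Relations

variable {θ : (⨂[k] _ : ι, WeylHayashiAlgebra k (u : k) t) →ₐ[k] Torus u ι} {i : ι} {a : ι → ℤ}
  {c : kˣ}

theorem map_psiDag_mul_psi (h : θ (singleAlgHom i ↑(omega u t)) = monoUnit u a c)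
    (h' : θ (singleAlgHom i ↑(omega u t)⁻¹) = (↑(monoUnit u a c)⁻¹ : Torus u ι)) :
    θ (singleAlgHom i (psiDag u t)) * θ (singleAlgHom i (psi u t)) =
      mono u 0 (bracket u t c a) := by
  rw [← map_mul, ← map_mul, psiDag_mul_psi, ← smul_monoUnit_pow_sub, ← h, ← h']
  simp only [map_smul, map_sub, map_pow]

theorem map_psi_mul_psiDag (h : θ (singleAlgHom i ↑(omega u t)) = monoUnit u a c)
    (h' : θ (singleAlgHom i ↑(omega u t)⁻¹) = (↑(monoUnit u a c)⁻¹ : Torus u ι)) :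
    θ (singleAlgHom i (psi u t)) * θ (singleAlgHom i (psiDag u t)) =
      mono u 0 (bracket u t (u * c) a) := by
  rw [← map_mul, ← map_mul, psi_mul_psiDag, ← smul_smul_monoUnit_pow_sub, ← h, ← h']
  simp only [map_smul, map_sub, map_pow]

/-- If either image vanished, the brackets with scalars `c` and `uc` would both vanish, giving
c^{2t} = 1 = (uc)^{2t} and hence u^{2t} = 1. -/
theorem map_psi_ne_zero_and_map_psiDag_ne_zero (hu : ¬IsOfFinOrder u) (ht : 0 < t)
    (h : θ (singleAlgHom i ↑(omega u t)) = monoUnit u a c)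
    (h' : θ (singleAlgHom i ↑(omega u t)⁻¹) = (↑(monoUnit u a c)⁻¹ : Torus u ι)) :
    θ (singleAlgHom i (psi u t)) ≠ 0 ∧ θ (singleAlgHom i (psiDag u t)) ≠ 0 := by
  rw [← not_or]
  intro h0
  have h1 := map_psiDag_mul_psi h h'
  have h2 := map_psi_mul_psiDag h h'
  have h3 : θ (singleAlgHom i (psiDag u t)) * θ (singleAlgHom i (psi u t)) = 0 ∧
      θ (singleAlgHom i (psi u t)) * θ (singleAlgHom i (psiDag u t)) = 0 := by
    rcases h0 with h0 | h0 <;> rw [h0] <;> exact ⟨by simp only [mul_zero, zero_mul], by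
      simp only [mul_zero, zero_mul]⟩
  rw [h3.1] at h1
  rw [h3.2] at h2
  have h4 := (bracket_eq_zero hu ht ((mono_eq_zero u).1 h1.symm)).2
  have h5 := (bracket_eq_zero hu ht ((mono_eq_zero u).1 h2.symm)).2
  rw [mul_pow, mul_inv, ← h4, mul_left_inj] at h5
  refine denominator_ne_zero hu ht ?_
  rw [sub_eq_zero]
  simpa using congrArg Units.val h5

theorem singleAlgHom_mul_omega {x : WeylHayashiAlgebra k (u : k) t} {v : kˣ} (i j : ι)
    (h : x * omega u t = (v : k) • (omega u t * x)) :
    singleAlgHom (R := k) (A := fun _ : ι => WeylHayashiAlgebra k (u : k) t) i x *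
        singleAlgHom j ↑(omega u t) =
      ((v ^ ((Pi.single i 1 : ι → ℤ) j) : kˣ) : k) •
        (singleAlgHom j ↑(omega u t) * singleAlgHom i x) := by
  by_cases hij : j = i
  · subst hij
    rw [← map_mul, h, map_smul, map_mul]
    simp
  · rw [Pi.single_eq_of_ne hij, zpow_zero, Units.val_one, one_smul]
    simp only [singleAlgHom_apply]
    exact Commute.tprod (Pi.mulSingle_commute (Ne.symm hij) _ _)

end Relations

section Endomorphism

/-- The degrees of the images of the generators under a homomorphism to the torus. -/
theorem exists_degree (hu : ¬IsOfFinOrder u) (ht : 0 < t)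
    (θ : (⨂[k] _ : ι, WeylHayashiAlgebra k (u : k) t) →ₐ[k] Torus u ι)
    {α : ι → ι → ℤ} {c : ι → kˣ}
    (hα : ∀ i, θ (singleAlgHom i ↑(omega u t)) = monoUnit u (α i) (c i))
    (hα' : ∀ i, θ (singleAlgHom i ↑(omega u t)⁻¹) = (↑(monoUnit u (α i) (c i))⁻¹ : Torus u ι)) :
    ∃ M : Matrix ι ι ℤ, M * (Matrix.of α).transpose = 1 ∧
      (∀ i, ∃ F, F ≠ 0 ∧ θ (singleAlgHom i (psi u t)) = mono u (M i) F) ∧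
      (∀ i, ∃ F, F ≠ 0 ∧ θ (singleAlgHom i (psiDag u t)) = mono u (-M i) F) := by
  have hw (i : ι) {m : ι → ℤ} (hm : comp u m (θ (singleAlgHom i (psi u t))) ≠ 0) (j : ι) :
      m ⬝ᵥ α j = (Pi.single i 1 : ι → ℤ) j := by
    refine weight_eq hu (c := c j) ?_ hm
    rw [← hα, ← map_mul, singleAlgHom_mul_omega i j (psi_mul_omega u t), map_smul, map_mul]
  have hw' (i : ι) {m : ι → ℤ} (hm : comp u m (θ (singleAlgHom i (psiDag u t))) ≠ 0) (j : ι) :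
      -m ⬝ᵥ α j = (Pi.single i 1 : ι → ℤ) j := by
    rw [neg_dotProduct, neg_eq_iff_eq_neg]
    refine weight_eq hu (c := c j) ?_ hm
    rw [← hα, ← map_mul, singleAlgHom_mul_omega i j (psiDag_mul_omega u t), map_smul, map_mul,
      inv_zpow', zpow_neg]
  have hex {x : Torus u ι} (hx : x ≠ 0) : ∃ m, comp u m x ≠ 0 := by
    by_contra! hc
    exact hx (torus_ext u fun m => by rw [hc, map_zero])
  choose M hM using fun i => hex (map_psi_ne_zero_and_map_psiDag_ne_zero hu ht (hα i) (hα' i)).1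
  have hone : Matrix.of M * (Matrix.of α).transpose = 1 := by
    ext i j
    rw [Matrix.one_eq_pi_single]
    exact hw i (hM i) j
  -- A one-sided inverse of a square integer matrix is two-sided, so the weights m·α_j determine m
  -- and each image has a single degree.
  have hinj : Function.Injective (Matrix.of α).mulVec := by
    have h1 := mul_eq_one_comm.1 hone
    have h2 : (Matrix.of M).transpose * Matrix.of α = 1 := by
      rw [← Matrix.transpose_inj, Matrix.transpose_mul, Matrix.transpose_transpose, h1,
        Matrix.transpose_one]
    intro x y hxy
    have := congrArg (Matrix.of M).transpose.mulVec hxy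
    simpa [h2] using this
  have huniq (i : ι) {m : ι → ℤ} (hm : ∀ j, m ⬝ᵥ α j = (Pi.single i 1 : ι → ℤ) j) : m = M i :=
    hinj (funext fun j => by
      simp only [Matrix.mulVec, Matrix.of_apply]
      rw [dotProduct_comm, hm j, dotProduct_comm, hw i (hM i) j])
  refine ⟨Matrix.of M, hone, fun i => ⟨_, hM i, ?_⟩, fun i => ?_⟩
  · exact eq_mono_of_comp_eq_zero fun l hl => huniq i (hw i hl)
  · have h0 := (map_psi_ne_zero_and_map_psiDag_ne_zero hu ht (hα i) (hα' i)).2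
    have h1 : θ (singleAlgHom i (psiDag u t)) = mono u (-M i) _ :=
      eq_mono_of_comp_eq_zero fun l hl => by rw [← huniq i (hw' i hl), neg_neg]
    refine ⟨_, fun h2 => h0 ?_, h1⟩
    rw [h1, h2, mono_zero]

theorem injective_of_degree
    (θ : (⨂[k] _ : ι, WeylHayashiAlgebra k (u : k) t) →ₐ[k] Torus u ι)
    {α : ι → ι → ℤ} {c : ι → kˣ}
    (hα : ∀ i, θ (singleAlgHom i ↑(omega u t)) = monoUnit u (α i) (c i)) {M : Matrix ι ι ℤ}
    (hM : M * (Matrix.of α).transpose = 1)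
    (h : ∀ i, ∃ F, F ≠ 0 ∧ θ (singleAlgHom i (psi u t)) = mono u (M i) F)
    (h' : ∀ i, ∃ F, F ≠ 0 ∧ θ (singleAlgHom i (psiDag u t)) = mono u (-M i) F) :
    Function.Injective θ := by
  have hM' : Matrix.of α * M.transpose = 1 := by
    rw [← Matrix.transpose_inj, Matrix.transpose_mul, Matrix.transpose_transpose, hM,
      Matrix.transpose_one]
  have hinj {A B : Matrix ι ι ℤ} (hAB : A * B = 1) :
      Function.Injective fun a : ι → ℤ => ∑ i, a i • A i := by
    intro x y hxy
    have hv (x : ι → ℤ) : ∑ i, x i • A i = Matrix.vecMul x A := (Matrix.vecMul_eq_sum x A).symm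
    simp only [hv] at hxy
    have := congrArg (Matrix.vecMul · B) hxy
    simpa [hAB] using this
  exact injective_of_graded θ (fun i => ⟨c i, hα i⟩) h h' (hinj hM') (hinj hM)

end Endomorphism

end WeylHayashi

/-! ### Surjectivity -/

namespace WeylHayashi

open PiTensorProduct

variable {k ι : Type*} [Field k] [Fintype ι] [DecidableEq ι] {u : kˣ} {t : ℕ}

/-- If `Ω ↦ c ω^a` and `Ψ, Ψ†` are sent to degrees `m, -m` with `m·a = 1`, then `a = m` is a
signed basis vector. -/
theorem exists_eq_single_of_degree (hu : ¬IsOfFinOrder u) (ht : 0 < t)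
    {x y : ⨂[k] _ : ι, WeylHayashiAlgebra k (u : k) t} {m a : ι → ℤ} {c : kˣ} {F G : Laurent k ι}
    (hx : rep u t x = mono u m F) (hy : rep u t y = mono u (-m) G)
    (hyx : rep u t y * rep u t x = mono u 0 (bracket u t c a)) (hma : m ⬝ᵥ a = 1) :
    ∃ j, (m = Pi.single j 1 ∧ a = Pi.single j 1) ∨ (m = -Pi.single j 1 ∧ a = -Pi.single j 1) := by
  rw [hx, hy, mono_mul_mono, neg_add_cancel] at hyx
  have hyx := mono_injective u 0 hyx
  -- Of the degrees `m` and `-m`, one is negative at `j`; so `F` or `G` is divisible by the bracket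
  -- of ω_j, and the product by it or a rescaling of it.
  have hsupp {j : ι} (hj : m j ≠ 0) {l : ι} (hl : l ≠ j) : a l = 0 := by
    rcases lt_or_gt_of_ne hj with hj | hj
    · have h1 := bracket_dvd_comp_rep hu ht x hj
      rw [hx, comp_mono_self] at h1
      have h2 := map_dvd (shift u (-m)) h1
      rw [shift_bracket] at h2
      exact apply_eq_zero_of_bracket_dvd hu ht (hyx ▸ h2.mul_left G) hl
    · have h1 := bracket_dvd_comp_rep hu ht y (m := -m) (j := j) (by simpa using hj)
      rw [hy, comp_mono_self] at h1
      exact apply_eq_zero_of_bracket_dvd hu ht (hyx ▸ h1.mul_right _) hl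
  obtain ⟨j, hj⟩ : ∃ j, m j ≠ 0 := by
    by_contra! h
    rw [funext h] at hma
    exact zero_ne_one ((zero_dotProduct a).symm.trans hma)
  have ha : a = Pi.single j (a j) := by
    funext l
    by_cases hl : l = j
    · subst hl; simp
    · rw [Pi.single_eq_of_ne hl, hsupp hj hl]
  have hmul : m j * a j = 1 := by
    rwa [ha, dotProduct_single] at hma
  have haj : a j ≠ 0 := right_ne_zero_of_mul_eq_one hmul
  have hm : m = Pi.single j (m j) := by
    funext l
    by_cases hl : l = j
    · subst hl; simp
    · rw [Pi.single_eq_of_ne hl]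
      by_contra hml
      exact haj (hsupp hml (Ne.symm hl))
  refine ⟨j, ?_⟩
  rcases Int.eq_one_or_neg_one_of_mul_eq_one' hmul with ⟨h1, h2⟩ | ⟨h1, h2⟩
  · left
    rw [hm, ha, h1, h2]
    exact ⟨rfl, rfl⟩
  · right
    rw [hm, ha, h1, h2, Pi.single_neg]
    exact ⟨rfl, rfl⟩

/-- Writing G = b_j g, the relation exhibits a bracket in ω_j as b_j times g and a shift of F. Both
cofactors are therefore units, so `x` and `y` are Ψ_j and Ψ†_j up to monomials in Ω. -/
theorem psi_mem_of_pos (hu : ¬IsOfFinOrder u) (ht : 0 < t)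
    {S : Subalgebra k (⨂[k] _ : ι, WeylHayashiAlgebra k (u : k) t)}
    (hS : ∀ a, omegaMon u t a ∈ S)
    {x y : ⨂[k] _ : ι, WeylHayashiAlgebra k (u : k) t} {j : ι} {c : kˣ} {F G : Laurent k ι}
    (hx : rep u t x = mono u (Pi.single j 1) F) (hy : rep u t y = mono u (-Pi.single j 1) G)
    (hyx : rep u t y * rep u t x = mono u 0 (bracket u t c (Pi.single j 1)))
    (hxS : x ∈ S) (hyS : y ∈ S) :
    singleAlgHom j (psi u t) ∈ S ∧ singleAlgHom j (psiDag u t) ∈ S := by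
  have h1 := bracket_dvd_comp_rep hu ht y (m := -Pi.single j 1) (j := j) (by simp)
  rw [hy, comp_mono_self] at h1
  obtain ⟨g, rfl⟩ := h1
  rw [hx, hy, mono_mul_mono, neg_add_cancel] at hyx
  have h2 := mono_injective u 0 hyx
  rw [mul_assoc, mul_comm] at h2
  have h3 := isUnit_of_mul_bracket hu ht h2
  rw [IsUnit.mul_iff] at h3
  exact ⟨mem_of_rep_eq hu ht hS (isUnit_of_isUnit_shift u h3.2) (by rw [hx, one_mul]) (rep_psi j) hxS,
    mem_of_rep_eq hu ht hS h3.1 hy (rep_psiDag j) hyS⟩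

theorem psi_mem_of_neg (hu : ¬IsOfFinOrder u) (ht : 0 < t)
    {S : Subalgebra k (⨂[k] _ : ι, WeylHayashiAlgebra k (u : k) t)}
    (hS : ∀ a, omegaMon u t a ∈ S)
    {x y : ⨂[k] _ : ι, WeylHayashiAlgebra k (u : k) t} {j : ι} {c : kˣ} {F G : Laurent k ι}
    (hx : rep u t x = mono u (-Pi.single j 1) F) (hy : rep u t y = mono u (Pi.single j 1) G)
    (hyx : rep u t y * rep u t x = mono u 0 (bracket u t c (-Pi.single j 1)))
    (hxS : x ∈ S) (hyS : y ∈ S) :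
    singleAlgHom j (psi u t) ∈ S ∧ singleAlgHom j (psiDag u t) ∈ S := by
  have h1 := bracket_dvd_comp_rep hu ht x (m := -Pi.single j 1) (j := j) (by simp)
  rw [hx, comp_mono_self] at h1
  obtain ⟨f, rfl⟩ := h1
  rw [hx, hy, mono_mul_mono, add_neg_cancel] at hyx
  have h2 := mono_injective u 0 hyx
  rw [map_mul, shift_bracket, mul_left_comm, mul_comm] at h2
  have h3 := isUnit_of_mul_bracket_neg hu ht h2
  rw [IsUnit.mul_iff] at h3
  exact ⟨mem_of_rep_eq hu ht hS h3.1 (by rw [hy, one_mul]) (rep_psi j) hyS,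
    mem_of_rep_eq hu ht hS (isUnit_of_isUnit_shift u h3.2) hx (rep_psiDag j) hxS⟩

theorem omegaMon_mem_of_rep_eq (hu : ¬IsOfFinOrder u) (ht : 0 < t)
    {S : Subalgebra k (⨂[k] _ : ι, WeylHayashiAlgebra k (u : k) t)}
    {x y : ⨂[k] _ : ι, WeylHayashiAlgebra k (u : k) t} {a : ι → ℤ} {c : kˣ}
    (hx : rep u t x = mono u 0 (AddMonoidAlgebra.single a (c : k)))
    (hy : rep u t y = mono u 0 (AddMonoidAlgebra.single a 1)) (hxS : x ∈ S) : y ∈ S := by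
  have : y = ((c⁻¹ : kˣ) : k) • x := by
    apply rep_injective hu ht
    rw [map_smul, hx, hy, smul_mono, AddMonoidAlgebra.smul_single]
    simp
  rw [this]
  exact S.smul_mem hxS _

/-- Every endomorphism of a tensor power of the Weyl-Hayashi algebra is bijective. -/
theorem bijective_of_algHom (hu : ¬IsOfFinOrder u) (ht : 0 < t)
    (φ : (⨂[k] _ : ι, WeylHayashiAlgebra k (u : k) t) →ₐ[k]
      (⨂[k] _ : ι, WeylHayashiAlgebra k (u : k) t)) : Function.Bijective φ := by
  let θ := (rep u t).comp φ
  have hθ (x) : θ x = rep u t (φ x) := rfl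
  have hunit (i : ι) : ∃ (a : ι → ℤ) (c : kˣ),
      θ (singleAlgHom i ↑(omega u t)) = (monoUnit u a c : Torus u ι) ∧
      θ (singleAlgHom i ↑(omega u t)⁻¹) = (↑(monoUnit u a c)⁻¹ : Torus u ι) :=
    exists_rep_unit hu ht (Units.map (φ.comp (singleAlgHom i)).toMonoidHom (omega u t))
  choose α c hα hα' using hunit
  obtain ⟨M, hM, hF, hG⟩ := exists_degree hu ht θ hα hα'
  have hinj : Function.Injective φ :=
    Function.Injective.of_comp (f := rep u t) (injective_of_degree θ hα hM hF hG)
  refine ⟨hinj, ?_⟩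
  choose F _ hF using hF
  choose G _ hG using hG
  have hdot (i j : ι) : M i ⬝ᵥ α j = if i = j then 1 else 0 := by
    rw [← Matrix.one_apply, ← hM]
    rfl
  have hrel (i : ι) := map_psiDag_mul_psi (hα i) (hα' i)
  choose σ hσ using fun i => exists_eq_single_of_degree hu ht (hF i) (hG i) (hrel i)
    ((hdot i i).trans (if_pos rfl))
  -- If σ i = σ j with i ≠ j, then M_i·α_j would be ±1 instead of 0. Finiteness then makes σ a
  -- permutation.
  have hσinj : Function.Injective σ := by
    intro i j hij
    by_contra hne
    have h0 : M i ⬝ᵥ α j = 0 := (hdot i j).trans (if_neg hne)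
    rcases hσ i with h1 | h1 <;> rcases hσ j with h2 | h2 <;>
      · rw [h1.1, h2.2, hij] at h0
        simp at h0
  have hσsurj := Finite.surjective_of_injective hσinj
  have hmem (x) : φ x ∈ φ.range := ⟨x, rfl⟩
  have hneg (i : ι) : rep u t (φ (singleAlgHom i ↑(omega u t)⁻¹)) =
      mono u 0 (AddMonoidAlgebra.single (-α i) (((c i)⁻¹ : kˣ) : k)) := hα' i
  have hom (j : ι) : singleAlgHom j ↑(omega u t) ∈ φ.range ∧
      singleAlgHom j ↑(omega u t)⁻¹ ∈ φ.range := by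
    obtain ⟨i, rfl⟩ := hσsurj j
    rcases hσ i with h | h
    · exact ⟨omegaMon_mem_of_rep_eq hu ht (hα i) (by rw [rep_omega, h.2]) (hmem _),
        omegaMon_mem_of_rep_eq hu ht (hneg i) (by rw [rep_omega_inv, h.2]) (hmem _)⟩
    · exact ⟨omegaMon_mem_of_rep_eq hu ht (hneg i) (by rw [rep_omega, h.2, neg_neg]) (hmem _),
        omegaMon_mem_of_rep_eq hu ht (hα i) (by rw [rep_omega_inv, h.2]) (hmem _)⟩
  have hmon := omegaMon_mem φ.range (fun j => (hom j).1) (fun j => (hom j).2)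
  have hpsi (j : ι) : singleAlgHom j (psi u t) ∈ φ.range ∧
      singleAlgHom j (psiDag u t) ∈ φ.range := by
    obtain ⟨i, rfl⟩ := hσsurj j
    have h1 := hrel i
    have h2 := hF i
    have h3 := hG i
    rcases hσ i with h | h
    · rw [h.1] at h2 h3
      rw [h.2] at h1
      exact psi_mem_of_pos hu ht hmon h2 h3 h1 (hmem _) (hmem _)
    · rw [h.1] at h2 h3
      rw [neg_neg] at h3
      rw [h.2] at h1
      exact psi_mem_of_neg hu ht hmon h2 h3 h1 (hmem _) (hmem _)
  have htop : φ.range = ⊤ := eq_top_of_single_mem φ.range fun j x => by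
    have := eq_top_of_mem (u := u) (t := t) (φ.range.comap
      (singleAlgHom (A := fun _ : ι => WeylHayashiAlgebra k (u : k) t) j)) (hom j).1 (hom j).2 (hpsi j).1 (hpsi j).2
    exact Subalgebra.mem_comap .. |>.1 (this.symm ▸ Algebra.mem_top)
  exact AlgHom.range_eq_top φ |>.1 htop

end WeylHayashi

theorem theorem1p4 {k : Type*} [Field k] (q : k) (hq0 : q ≠ 0)
    (hq : ∀ m : ℕ, 0 < m → q ^ m ≠ 1) (t n : ℕ) (ht : 0 < t) (hn : 0 < n)
    (φ : (⨂[k] _ : Fin n, WeylHayashiAlgebra k q t) →ₐ[k]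
      (⨂[k] _ : Fin n, WeylHayashiAlgebra k q t)) :
    Function.Bijective φ := by
  lift q to kˣ using hq0.isUnit
  refine WeylHayashi.bijective_of_algHom (fun hfin => ?_) ht φ
  obtain ⟨m, hm, h⟩ := isOfFinOrder_iff_pow_eq_one.1 hfin
  exact hq m hm (by rw [← Units.val_pow_eq_pow_val, h, Units.val_one])
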